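/- Let $n\ge 1$ and let $(M,\varphi,\xi,\eta,g)$ be a $(2n+1)$-dimensional almost contact complex Riemannian (accR) manifold: $M$ is a smooth manifold, $\varphi$ is a smooth endomorphism field of $TM$, $\xi$ a smooth vector field, $\eta$ a smooth 1-form and $g$ a smooth pseudo-Riemannian metric of signature $(n+1,n)$ with $$\varphi\xi=0,\quad \varphi^2=-\mathrm{id}+\eta\otimes\xi,\quad \eta\circ\varphi=0,\quad \eta(\xi)=1,\quad g(\varphi x,\varphi y)=-g(x,y)+\eta(x)\eta(y).$$ Let $\tilde g(x,y)=g(x,\varphi y)+\eta(x)\eta(y)$ be the associated metric, $\nabla$ the Levi-Civita connection and $\rho$ the Ricci tensor of $g$ (with $\rho(y,z)=\operatorname{tr}(x\mapsto R(x,y)z)$ and $R(x,y)z=\nabla_x\nabla_yz-\nabla_y\nabla_xz-\nabla_{[x,y]}z$), and let $\tau$, $\tilde\tau$ be the scalar curvatures of $g$ and of $\tilde g$, each taken with respect to the metric itself and its own Levi-Civita connection. Assume that the manifold is Sasaki-like, i.e. $$g\bigl((\nabla_x\varphi)y,z\bigr)=g(\varphi x,\varphi y)\eta(z)+g(\varphi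 x,\varphi z)\eta(y),$$ and that, for a real constant $\beta$ and functions $\lambda,\tilde\lambda$ on $M$, it is a $\beta$-Ricci–Bourguignon-like almost soliton with vertical potential $\vartheta=k\xi$, where $k$ is a differentiable function on $M$, i.e. $$\rho+\tfrac12\mathcal L_{\vartheta}g+\tfrac12\mathcal L_{\vartheta}\tilde g+(\lambda+\beta\tau)g+(\tilde\lambda+\beta\tilde\tau)\tilde g=0 .$$ Then the manifold is almost Einstein-like (that is, $\rho=a\,g+b\,\tilde g+c\,\eta\otimes\eta$ for some functions $a,b,c$ on $M$), and precisely $$\rho=\Bigl(\frac{\tau}{2n}-1\Bigr)g+\Bigl(\frac{\tilde\tau}{2n}-1\Bigr)\tilde g-\Bigl\{\frac{\tau+\tilde\tau}{2n}-2(n+1)\Bigr\}\eta\otimes\eta .$$ Moreover $\mathrm dk=\mathrm dk(\xi)\,\eta$. If $\beta\ne-\frac1{2n}$, then $$\tau=-\frac{2n}{1+2n\beta}(\lambda+k-1),\qquad \tilde\tau=-\frac{2n}{1+2n\beta}(\tilde\lambda-k-1),\qquad \mathrm dk(\xi)=-\frac{\lambda+\tilde\lambda-2}{2(1+2n\beta)}-n-1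 .$$ If $\beta=-\frac1{2n}$, then $$\tau+\tilde\tau=4n\{\mathrm dk(\xi)+n+1\},\qquad \lambda=1-k,\qquad \tilde\lambda=1+k .$$ -/

import Mathlib

open scoped Manifold ContDiff Bundle

noncomputable section

namespace AccR

section Geometry

variable {E : Type*} [NormedAddCommGroup E] [NormedSpace ℝ E] [FiniteDimensional ℝ E]
  {M : Type*} [TopologicalSpace M] [ChartedSpace E M] [IsManifold 𝓘(ℝ, E) ∞ M]

/-- Vector fields on a manifold modelled on `E` (no regularity imposed). -/
abbrev VField (E : Type*) [NormedAddCommGroup E] [NormedSpace ℝ E]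
    (M : Type*) [TopologicalSpace M] [ChartedSpace E M] : Type _ :=
  ∀ p : M, TangentSpace 𝓘(ℝ, E) p

/-- Fields of real valued functions of two tangent vectors; `(0,2)`-tensor fields are evaluated
as such. -/
abbrev Form2 (E : Type*) [NormedAddCommGroup E] [NormedSpace ℝ E]
    (M : Type*) [TopologicalSpace M] [ChartedSpace E M] : Type _ :=
  ∀ p : M, TangentSpace 𝓘(ℝ, E) p → TangentSpace 𝓘(ℝ, E) p → ℝ

/-- The derivative `X f` of a function along a vector field, at the point `p`. -/
def dirDeriv (X : VField E M) (f : M → ℝ) (p : M) : ℝ :=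
  mvfderiv 𝓘(ℝ, E) f p (X p)

/-- The Lie bracket of vector fields. -/
def bracket (X Y : VField E M) : VField E M :=
  VectorField.mlieBracket 𝓘(ℝ, E) X Y

/-- Extension of a tangent vector at `p` to a vector field which is smooth around `p`. -/
def ext {p : M} (v : TangentSpace 𝓘(ℝ, E) p) : VField E M :=
  FiberBundle.extend E v

/-- A basis of the tangent space at `p`. The traces below do not depend on its choice. -/
def tangentBasis (p : M) :
    Module.Basis (Fin (Module.finrank ℝ E)) ℝ (TangentSpace 𝓘(ℝ, E) p) :=
  Module.finBasis ℝ E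

/-- The Gram matrix `g_{ij}` of `g` at `p`. -/
def gram (g : Form2 E M) (p : M) :
    Matrix (Fin (Module.finrank ℝ E)) (Fin (Module.finrank ℝ E)) ℝ :=
  Matrix.of fun i j ↦ g p (tangentBasis p i) (tangentBasis p j)

/-- The trace `g^{ij} B(e_i, e_j)` of `B` with respect to `g` at `p`. -/
def metricTrace (g : Form2 E M) (p : M)
    (B : TangentSpace 𝓘(ℝ, E) p → TangentSpace 𝓘(ℝ, E) p → ℝ) : ℝ :=
  ∑ i, ∑ j, (gram g p)⁻¹ i j * B (tangentBasis p i) (tangentBasis p j)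

/-- Raising an index: for nondegenerate symmetric `g` and linear `α`, this is the vector `u` with
`g(u, w) = α(w)` for all `w`. -/
def sharp (g : Form2 E M) (p : M) (α : TangentSpace 𝓘(ℝ, E) p → ℝ) :
    TangentSpace 𝓘(ℝ, E) p :=
  ∑ i, (∑ j, (gram g p)⁻¹ i j * α (tangentBasis p j)) • tangentBasis p i

/-- The right-hand side of the Koszul formula, that is `2 g(∇_X Y, Z)`. -/
def koszul (g : Form2 E M) (X Y Z : VField E M) (p : M) : ℝ :=
  dirDeriv X (fun q ↦ g q (Y q) (Z q)) p + dirDeriv Y (fun q ↦ g q (X q) (Z q)) p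
    - dirDeriv Z (fun q ↦ g q (X q) (Y q)) p
    + g p (bracket X Y p) (Z p) - g p (bracket X Z p) (Y p) - g p (bracket Y Z p) (X p)

/-- The Levi-Civita connection `∇_X Y` of `g`, given by the Koszul formula. -/
def nabla (g : Form2 E M) (X Y : VField E M) : VField E M :=
  fun p ↦ sharp g p fun w ↦ koszul g X Y (ext w) p / 2

/-- The curvature `R(X,Y)Z = ∇_X ∇_Y Z - ∇_Y ∇_X Z - ∇_{[X,Y]} Z` of `g`. -/
def curvature (g : Form2 E M) (X Y Z : VField E M) : VField E M :=
  nabla g X (nabla g Y Z) - nabla g Y (nabla g X Z) - nabla g (bracket X Y) Z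

/-- The Ricci tensor `ρ(y,z) = tr (x ↦ R(x,y)z)` of `g`. -/
def ricci (g : Form2 E M) : Form2 E M := fun p y z ↦
  ∑ i, (tangentBasis p).coord i (curvature g (ext (tangentBasis p i)) (ext y) (ext z) p)

/-- The scalar curvature of `g`: the trace with respect to `g` of the Ricci tensor of `g`. -/
def scalarCurvature (g : Form2 E M) (p : M) : ℝ :=
  metricTrace g p (ricci g p)

/-- The Lie derivative `(𝓛_ϑ g)(x,y) = ϑ(g(x,y)) - g([ϑ,x],y) - g(x,[ϑ,y])`. -/
def lieDeriv (ϑ : VField E M) (g : Form2 E M) : Form2 E M := fun p x y ↦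
  dirDeriv ϑ (fun q ↦ g q (ext x q) (ext y q)) p
    - g p (bracket ϑ (ext x) p) y - g p x (bracket ϑ (ext y) p)

end Geometry

/-- The model space of `(2n+1)`-dimensional manifolds. -/
abbrev Model (n : ℕ) : Type := EuclideanSpace ℝ (Fin (2 * n + 1))

/-- An almost contact complex Riemannian structure (almost contact B-metric structure)
`(φ, ξ, η, g)` on a `(2n+1)`-dimensional smooth manifold `M`. -/
structure AccRStructure (n : ℕ) (M : Type*) [TopologicalSpace M] [ChartedSpace (Model n) M]
    [IsManifold 𝓘(ℝ, Model n) ∞ M] where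
  /-- the endomorphism of the tangent bundle -/
  φ : ∀ p : M, TangentSpace 𝓘(ℝ, Model n) p →L[ℝ] TangentSpace 𝓘(ℝ, Model n) p
  /-- the Reeb vector field -/
  ξ : ∀ p : M, TangentSpace 𝓘(ℝ, Model n) p
  /-- the contact 1-form -/
  η : ∀ p : M, TangentSpace 𝓘(ℝ, Model n) p →L[ℝ] ℝ
  /-- the B-metric -/
  g : ∀ p : M, TangentSpace 𝓘(ℝ, Model n) p →L[ℝ] TangentSpace 𝓘(ℝ, Model n) p →L[ℝ] ℝ
  smooth_φ : ContMDiff 𝓘(ℝ, Model n) (𝓘(ℝ, Model n).prod 𝓘(ℝ, Model n →L[ℝ] Model n)) ∞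
    (fun p ↦ Bundle.TotalSpace.mk' (Model n →L[ℝ] Model n)
      (E := fun p : M ↦ TangentSpace 𝓘(ℝ, Model n) p →L[ℝ] TangentSpace 𝓘(ℝ, Model n) p) p (φ p))
  smooth_ξ : ContMDiff 𝓘(ℝ, Model n) (𝓘(ℝ, Model n).prod 𝓘(ℝ, Model n)) ∞
    (fun p ↦ Bundle.TotalSpace.mk' (Model n)
      (E := fun p : M ↦ TangentSpace 𝓘(ℝ, Model n) p) p (ξ p))
  smooth_η : ContMDiff 𝓘(ℝ, Model n) (𝓘(ℝ, Model n).prod 𝓘(ℝ, Model n →L[ℝ] ℝ)) ∞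
    (fun p ↦ Bundle.TotalSpace.mk' (Model n →L[ℝ] ℝ)
      (E := fun p : M ↦ TangentSpace 𝓘(ℝ, Model n) p →L[ℝ] ℝ) p (η p))
  smooth_g : ContMDiff 𝓘(ℝ, Model n)
    (𝓘(ℝ, Model n).prod 𝓘(ℝ, Model n →L[ℝ] Model n →L[ℝ] ℝ)) ∞
    (fun p ↦ Bundle.TotalSpace.mk' (Model n →L[ℝ] Model n →L[ℝ] ℝ)
      (E := fun p : M ↦ TangentSpace 𝓘(ℝ, Model n) p →L[ℝ]
        TangentSpace 𝓘(ℝ, Model n) p →L[ℝ] ℝ) p (g p))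
  g_symm : ∀ (p : M) (x y : TangentSpace 𝓘(ℝ, Model n) p), g p x y = g p y x
  /-- `g` is pseudo-Riemannian of signature `(n+1, n)`. -/
  g_signature : ∀ p : M,
    ∃ b : Module.Basis (Fin (n + 1) ⊕ Fin n) ℝ (TangentSpace 𝓘(ℝ, Model n) p),
      (∀ i j, i ≠ j → g p (b i) (b j) = 0) ∧
      (∀ i, g p (b (Sum.inl i)) (b (Sum.inl i)) = 1) ∧
      (∀ j, g p (b (Sum.inr j)) (b (Sum.inr j)) = -1)
  φ_ξ : ∀ p : M, φ p (ξ p) = 0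
  φ_φ : ∀ (p : M) (x : TangentSpace 𝓘(ℝ, Model n) p), φ p (φ p x) = -x + η p x • ξ p
  η_φ : ∀ (p : M) (x : TangentSpace 𝓘(ℝ, Model n) p), η p (φ p x) = 0
  η_ξ : ∀ p : M, η p (ξ p) = 1
  g_φ_φ : ∀ (p : M) (x y : TangentSpace 𝓘(ℝ, Model n) p),
    g p (φ p x) (φ p y) = -g p x y + η p x * η p y

namespace AccRStructure

variable {n : ℕ} {M : Type*} [TopologicalSpace M] [ChartedSpace (Model n) M]
  [IsManifold 𝓘(ℝ, Model n) ∞ M]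

/-- The B-metric `g` as a function of pairs of tangent vectors. -/
def metric (S : AccRStructure n M) : Form2 (Model n) M := fun p x y ↦ S.g p x y

/-- The associated B-metric `g̃(x,y) = g(x,φy) + η(x)η(y)`. -/
def assocMetric (S : AccRStructure n M) : Form2 (Model n) M := fun p x y ↦
  S.g p x (S.φ p y) + S.η p x * S.η p y

/-- The tensor `F(x,y,z) = g((∇_x φ)y, z)`, where `(∇_x φ)y = ∇_x(φy) - φ(∇_x y)` and `∇` is the
Levi-Civita connection of `g`. -/
def F (S : AccRStructure n M) (p : M) (x y z : TangentSpace 𝓘(ℝ, Model n) p) : ℝ :=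
  S.g p (nabla S.metric (ext x) (fun q ↦ S.φ q (ext y q)) p
    - S.φ p (nabla S.metric (ext x) (ext y) p)) z

/-- The Sasaki-like condition `F(x,y,z) = g(φx,φy)η(z) + g(φx,φz)η(y)`. -/
def IsSasakiLike (S : AccRStructure n M) : Prop :=
  ∀ (p : M) (x y z : TangentSpace 𝓘(ℝ, Model n) p),
    S.F p x y z = S.g p (S.φ p x) (S.φ p y) * S.η p z + S.g p (S.φ p x) (S.φ p z) * S.η p y

/-- The Ricci tensor `ρ` of `g`. -/
def ρ (S : AccRStructure n M) : Form2 (Model n) M := ricci S.metric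

/-- The scalar curvature `τ` of `g`. -/
def τ (S : AccRStructure n M) : M → ℝ := scalarCurvature S.metric

/-- The scalar curvature `τ̃` of the associated metric `g̃`, taken with respect to `g̃` and its own
Levi-Civita connection. -/
def τT (S : AccRStructure n M) : M → ℝ := scalarCurvature S.assocMetric

/-- `S` is almost Einstein-like with coefficient functions `(a,b,c)`:
`ρ = a g + b g̃ + c η ⊗ η`. -/
def IsAlmostEinsteinLike (S : AccRStructure n M) (a b c : M → ℝ) : Prop :=
  ∀ (p : M) (x y : TangentSpace 𝓘(ℝ, Model n) p),
    S.ρ p x y = a p * S.metric p x y + b p * S.assocMetric p x y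
      + c p * (S.η p x * S.η p y)

/-- `S` is a `β`-Ricci-Bourguignon-like almost soliton with potential `ϑ` and soliton functions
`(lam, lamT)`:
`ρ + ½ 𝓛_ϑ g + ½ 𝓛_ϑ g̃ + (λ + βτ) g + (λ̃ + βτ̃) g̃ = 0`. -/
def IsRBLikeAlmostSoliton (S : AccRStructure n M) (β : ℝ) (ϑ : VField (Model n) M)
    (lam lamT : M → ℝ) : Prop :=
  ∀ (p : M) (x y : TangentSpace 𝓘(ℝ, Model n) p),
    S.ρ p x y + 1 / 2 * lieDeriv ϑ S.metric p x y + 1 / 2 * lieDeriv ϑ S.assocMetric p x y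
      + (lam p + β * S.τ p) * S.metric p x y
      + (lamT p + β * S.τT p) * S.assocMetric p x y = 0

end AccRStructure

end AccR

end

/-! On a Sasaki-like manifold `∇_X ξ = -φX`, hence `R(X,Y)ξ = η(Y)X - η(X)Y` and `ρ(y,ξ) = 2n η(y)`.
The connection of `g̃` is `∇ + D ⊗ ξ` with `D` the form `defect`, and `D(·,ξ) = 0`, so `∇̃ξ = -φ` as
well. Therefore `½ 𝓛_{kξ} g + ½ 𝓛_{kξ} g̃ = k g - k g̃ + dk ⊗ η + η ⊗ dk`, and the soliton equation
becomes `ρ = -a g - b g̃ - dk ⊗ η - η ⊗ dk` with `a = λ + βτ + k` and `b = λ̃ + βτ̃ - k`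
(`ricci_of_soliton`).

Putting `ξ` in one slot forces `dk = d η` with `d = dk(ξ)`, and `a + b + 2d = -2n`. Two more
equations come from the traces with respect to `g` and `g̃`. The second trace is `τ̃` because both
metrics have the same Ricci tensor (`ricci_assocMetric`): the difference of the curvatures is an
explicit endomorphism whose trace vanishes, using `tr φ = 0`. The outcome is `a = 1 - τ/2n`, `b = 1
- τ̃/2n` (`soliton_coefficients`); the rest is algebra in `β`.

Vector fields carry no regularity and `∇` is defined by the Koszul formula on chosen extensions, so
the Levi-Civita calculus is first derived for fields differentiable, or `C²`, at a point. -/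

noncomputable section

open Filter Topology

set_option linter.unusedSectionVars false

namespace AccR

/-! ### The Koszul formula and its tensoriality. -/

section LeviCivita

variable {E : Type*} [NormedAddCommGroup E] [NormedSpace ℝ E] [FiniteDimensional ℝ E]
  {M : Type*} [TopologicalSpace M] [ChartedSpace E M] [IsManifold 𝓘(ℝ, E) ∞ M]

/-- A field of nondegenerate symmetric bilinear forms on the tangent spaces, smooth in the sense
that it takes regular vector fields to regular functions. -/
structure IsMetric (g : Form2 E M) : Prop where
  add_left : ∀ (p : M) (x y z : TangentSpace 𝓘(ℝ, E) p), g p (x + y) z = g p x z + g p y z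
  smul_left : ∀ (p : M) (a : ℝ) (x z : TangentSpace 𝓘(ℝ, E) p), g p (a • x) z = a * g p x z
  symm : ∀ (p : M) (x y : TangentSpace 𝓘(ℝ, E) p), g p x y = g p y x
  nondeg : ∀ (p : M) (x : TangentSpace 𝓘(ℝ, E) p), (∀ y, g p x y = 0) → x = 0
  mdiffAt : ∀ {X Y : VField E M} {p : M}, MDiffAt (T% X) p → MDiffAt (T% Y) p →
    MDiffAt (fun q ↦ g q (X q) (Y q)) p
  contMDiffAt : ∀ {X Y : VField E M} {p : M}, CMDiffAt 2 (T% X) p → CMDiffAt 2 (T% Y) p →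
    CMDiffAt 2 (fun q ↦ g q (X q) (Y q)) p

lemma dirDeriv_add (X : VField E M) {f h : M → ℝ} {p : M} (hf : MDiffAt f p) (hh : MDiffAt h p) :
    dirDeriv X (fun q ↦ f q + h q) p = dirDeriv X f p + dirDeriv X h p := by
  simp [dirDeriv, mvfderiv_fun_add hf hh]

lemma dirDeriv_mul (X : VField E M) {f h : M → ℝ} {p : M} (hf : MDiffAt f p) (hh : MDiffAt h p) :
    dirDeriv X (fun q ↦ f q * h q) p = f p * dirDeriv X h p + h p * dirDeriv X f p := by
  simp [dirDeriv, mvfderiv_fun_mul hf hh]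

namespace IsMetric
variable {g : Form2 E M} (hg : IsMetric g)
include hg

lemma add_right (p : M) (x y z : TangentSpace 𝓘(ℝ, E) p) : g p z (x + y) = g p z x + g p z y := by
  rw [hg.symm, hg.add_left, hg.symm p x, hg.symm p y]

lemma smul_right (p : M) (a : ℝ) (x z : TangentSpace 𝓘(ℝ, E) p) : g p z (a • x) = a * g p z x := by
  rw [hg.symm, hg.smul_left, hg.symm p x]

/-- The derivatives of `f` from the product rule cancel those from `[X, fZ]` and `[Y, fZ]`. This is
what makes the extension chosen in `nabla` immaterial. -/
lemma koszul_smul_right {X Y Z : VField E M} {f : M → ℝ} {p : M} (hX : MDiffAt (T% X) p)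
    (hY : MDiffAt (T% Y) p) (hZ : MDiffAt (T% Z) p) (hf : MDiffAt f p) :
    koszul g X Y (f • Z) p = f p * koszul g X Y Z p := by
  have h1 : dirDeriv X (fun q ↦ g q (Y q) ((f • Z) q)) p
      = f p * dirDeriv X (fun q ↦ g q (Y q) (Z q)) p + g p (Y p) (Z p) * dirDeriv X f p := by
    rw [← dirDeriv_mul X hf (hg.mdiffAt hY hZ)]
    congr 1; ext q; exact hg.smul_right q _ _ _
  have h2 : dirDeriv Y (fun q ↦ g q (X q) ((f • Z) q)) p
      = f p * dirDeriv Y (fun q ↦ g q (X q) (Z q)) p + g p (X p) (Z p) * dirDeriv Y f p := by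
    rw [← dirDeriv_mul Y hf (hg.mdiffAt hX hZ)]
    congr 1; ext q; exact hg.smul_right q _ _ _
  have h3 : dirDeriv (f • Z) (fun q ↦ g q (X q) (Y q)) p
      = f p * dirDeriv Z (fun q ↦ g q (X q) (Y q)) p := by
    simp [dirDeriv]
  have h4 : bracket X (f • Z) p = dirDeriv X f p • Z p + f p • bracket X Z p :=
    VectorField.mlieBracket_smul_right hf hZ
  have h5 : bracket Y (f • Z) p = dirDeriv Y f p • Z p + f p • bracket Y Z p :=
    VectorField.mlieBracket_smul_right hf hZ
  simp only [koszul, h1, h2, h3, h4, h5, hg.add_left, hg.smul_left]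
  rw [show g p (bracket X Y p) ((f • Z) p) = f p * g p (bracket X Y p) (Z p) from
    hg.smul_right p _ _ _, hg.symm p (Z p), hg.symm p (Z p)]
  ring

lemma koszul_add_right {X Y Z W : VField E M} {p : M} (hX : MDiffAt (T% X) p)
    (hY : MDiffAt (T% Y) p) (hZ : MDiffAt (T% Z) p) (hW : MDiffAt (T% W) p) :
    koszul g X Y (Z + W) p = koszul g X Y Z p + koszul g X Y W p := by
  have h1 : dirDeriv X (fun q ↦ g q (Y q) ((Z + W) q)) p
      = dirDeriv X (fun q ↦ g q (Y q) (Z q)) p + dirDeriv X (fun q ↦ g q (Y q) (W q)) p := by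
    rw [← dirDeriv_add X (hg.mdiffAt hY hZ) (hg.mdiffAt hY hW)]
    congr 1; ext q; exact hg.add_right q _ _ _
  have h2 : dirDeriv Y (fun q ↦ g q (X q) ((Z + W) q)) p
      = dirDeriv Y (fun q ↦ g q (X q) (Z q)) p + dirDeriv Y (fun q ↦ g q (X q) (W q)) p := by
    rw [← dirDeriv_add Y (hg.mdiffAt hX hZ) (hg.mdiffAt hX hW)]
    congr 1; ext q; exact hg.add_right q _ _ _
  have h3 : dirDeriv (Z + W) (fun q ↦ g q (X q) (Y q)) p
      = dirDeriv Z (fun q ↦ g q (X q) (Y q)) p + dirDeriv W (fun q ↦ g q (X q) (Y q)) p := by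
    simp [dirDeriv]
  have h4 : bracket X (Z + W) p = bracket X Z p + bracket X W p :=
    VectorField.mlieBracket_add_right hZ hW
  have h5 : bracket Y (Z + W) p = bracket Y Z p + bracket Y W p :=
    VectorField.mlieBracket_add_right hZ hW
  simp only [koszul, h1, h2, h3, h4, h5, hg.add_left]
  rw [show g p (bracket X Y p) ((Z + W) p) = g p (bracket X Y p) (Z p) + g p (bracket X Y p) (W p)
    from hg.add_right p _ _ _]
  ring

/-- The Koszul expression is a tensor in its last argument. -/
lemma tensorialAt_koszul {X Y : VField E M} {p : M} (hX : MDiffAt (T% X) p)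
    (hY : MDiffAt (T% Y) p) :
    TensorialAt 𝓘(ℝ, E) E (fun Z : VField E M ↦ koszul g X Y Z p) p where
  smul hf hZ := hg.koszul_smul_right hX hY hZ hf
  add hZ hW := hg.koszul_add_right hX hY hZ hW

lemma koszul_smul_left {X Y Z : VField E M} {f : M → ℝ} {p : M} (hX : MDiffAt (T% X) p)
    (hY : MDiffAt (T% Y) p) (hZ : MDiffAt (T% Z) p) (hf : MDiffAt f p) :
    koszul g (f • X) Y Z p = f p * koszul g X Y Z p := by
  have h1 : dirDeriv Y (fun q ↦ g q ((f • X) q) (Z q)) p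
      = f p * dirDeriv Y (fun q ↦ g q (X q) (Z q)) p + g p (X p) (Z p) * dirDeriv Y f p := by
    rw [← dirDeriv_mul Y hf (hg.mdiffAt hX hZ)]
    congr 1; ext q; exact hg.smul_left q _ _ _
  have h2 : dirDeriv Z (fun q ↦ g q ((f • X) q) (Y q)) p
      = f p * dirDeriv Z (fun q ↦ g q (X q) (Y q)) p + g p (X p) (Y p) * dirDeriv Z f p := by
    rw [← dirDeriv_mul Z hf (hg.mdiffAt hX hY)]
    congr 1; ext q; exact hg.smul_left q _ _ _
  have h3 : dirDeriv (f • X) (fun q ↦ g q (Y q) (Z q)) p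
      = f p * dirDeriv X (fun q ↦ g q (Y q) (Z q)) p := by
    simp [dirDeriv]
  have h4 : bracket (f • X) Y p = (-dirDeriv Y f p) • X p + f p • bracket X Y p :=
    VectorField.mlieBracket_smul_left hf hX
  have h5 : bracket (f • X) Z p = (-dirDeriv Z f p) • X p + f p • bracket X Z p :=
    VectorField.mlieBracket_smul_left hf hX
  simp only [koszul, h1, h2, h3, h4, h5, hg.add_left, hg.smul_left]
  rw [show g p (bracket Y Z p) ((f • X) p) = f p * g p (bracket Y Z p) (X p) from
    hg.smul_right p _ _ _]
  ring

lemma koszul_add_left {X Y Z W : VField E M} {p : M} (hX : MDiffAt (T% X) p)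
    (hW : MDiffAt (T% W) p) (hY : MDiffAt (T% Y) p) (hZ : MDiffAt (T% Z) p) :
    koszul g (X + W) Y Z p = koszul g X Y Z p + koszul g W Y Z p := by
  have h1 : dirDeriv Y (fun q ↦ g q ((X + W) q) (Z q)) p
      = dirDeriv Y (fun q ↦ g q (X q) (Z q)) p + dirDeriv Y (fun q ↦ g q (W q) (Z q)) p := by
    rw [← dirDeriv_add Y (hg.mdiffAt hX hZ) (hg.mdiffAt hW hZ)]
    congr 1; ext q; exact hg.add_left q _ _ _
  have h2 : dirDeriv Z (fun q ↦ g q ((X + W) q) (Y q)) p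
      = dirDeriv Z (fun q ↦ g q (X q) (Y q)) p + dirDeriv Z (fun q ↦ g q (W q) (Y q)) p := by
    rw [← dirDeriv_add Z (hg.mdiffAt hX hY) (hg.mdiffAt hW hY)]
    congr 1; ext q; exact hg.add_left q _ _ _
  have h3 : dirDeriv (X + W) (fun q ↦ g q (Y q) (Z q)) p
      = dirDeriv X (fun q ↦ g q (Y q) (Z q)) p + dirDeriv W (fun q ↦ g q (Y q) (Z q)) p := by
    simp [dirDeriv]
  have h4 : bracket (X + W) Y p = bracket X Y p + bracket W Y p :=
    VectorField.mlieBracket_add_left hX hW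
  have h5 : bracket (X + W) Z p = bracket X Z p + bracket W Z p :=
    VectorField.mlieBracket_add_left hX hW
  simp only [koszul, h1, h2, h3, h4, h5, hg.add_left]
  rw [show g p (bracket Y Z p) ((X + W) p) = g p (bracket Y Z p) (X p) + g p (bracket Y Z p) (W p)
    from hg.add_right p _ _ _]
  ring

/-- The Koszul expression is a tensor in its first argument. -/
lemma tensorialAt_koszul_left {Y Z : VField E M} {p : M} (hY : MDiffAt (T% Y) p)
    (hZ : MDiffAt (T% Z) p) :
    TensorialAt 𝓘(ℝ, E) E (fun X : VField E M ↦ koszul g X Y Z p) p where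
  smul hf hX := hg.koszul_smul_left hX hY hZ hf
  add hX hW := hg.koszul_add_left hX hW hY hZ

/-- The bilinear form at a point, bundled. -/
def bilin (p : M) : LinearMap.BilinForm ℝ (TangentSpace 𝓘(ℝ, E) p) :=
  LinearMap.mk₂ ℝ (g p) (hg.add_left p) (hg.smul_left p) (fun z x y ↦ hg.add_right p x y z)
    (fun a x z ↦ hg.smul_right p a z x)

/-- An arbitrary basis is allowed because local frames are needed besides `tangentBasis`. -/
lemma isUnit_det_of_basis {ι : Type*} [Fintype ι] [DecidableEq ι] {p : M}
    (b : Module.Basis ι ℝ (TangentSpace 𝓘(ℝ, E) p)) :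
    IsUnit (Matrix.of fun i j ↦ g p (b i) (b j)).det := by
  have h : (hg.bilin p).Nondegenerate := by
    refine ⟨fun x hx ↦ hg.nondeg p x hx, fun x hx ↦ hg.nondeg p x fun y ↦ ?_⟩
    rw [hg.symm]; exact hx y
  have := (LinearMap.BilinForm.nondegenerate_iff_det_ne_zero (B := hg.bilin p) b).1 h
  have e : LinearMap.BilinForm.toMatrix b (hg.bilin p) = Matrix.of fun i j ↦ g p (b i) (b j) := by
    ext i j; simp [bilin, LinearMap.BilinForm.toMatrix_apply]
  rw [e] at this
  exact this.isUnit

lemma isUnit_gram_det (p : M) : IsUnit (gram g p).det :=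
  hg.isUnit_det_of_basis (tangentBasis p)

lemma sharp_left (p : M) (α : TangentSpace 𝓘(ℝ, E) p →ₗ[ℝ] ℝ) (w : TangentSpace 𝓘(ℝ, E) p) :
    g p (sharp g p α) w = α w := by
  suffices h : hg.bilin p (sharp g p α) = α from congrArg (fun L ↦ L w) h
  refine (tangentBasis p).ext fun k ↦ ?_
  have e : ∀ i, hg.bilin p (tangentBasis p i) (tangentBasis p k) = gram g p k i := fun i ↦
    hg.symm p _ _
  have hinv : gram g p * (gram g p)⁻¹ = 1 := Matrix.mul_nonsing_inv _ (hg.isUnit_gram_det p)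
  have h2 : (gram g p).mulVec ((gram g p)⁻¹.mulVec fun j ↦ α (tangentBasis p j)) k
      = α (tangentBasis p k) := by
    rw [Matrix.mulVec_mulVec, hinv, Matrix.one_mulVec]
  rw [← h2]
  simp only [sharp, map_sum, map_smul, LinearMap.sum_apply, LinearMap.smul_apply, e, smul_eq_mul,
    Matrix.mulVec, dotProduct]
  exact Finset.sum_congr rfl fun i _ ↦ mul_comm _ _

lemma ext_of_left {p : M} {x y : TangentSpace 𝓘(ℝ, E) p} (h : ∀ z, g p x z = g p y z) : x = y := by
  rw [← sub_eq_zero]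
  refine hg.nondeg p _ fun z ↦ ?_
  rw [sub_eq_add_neg, ← neg_one_smul ℝ y, hg.add_left, hg.smul_left, h]
  ring

/-- The Koszul formula. -/
lemma nabla_left {X Y Z : VField E M} {p : M} (hX : MDiffAt (T% X) p) (hY : MDiffAt (T% Y) p)
    (hZ : MDiffAt (T% Z) p) : g p (nabla g X Y p) (Z p) = koszul g X Y Z p / 2 := by
  -- Tensoriality makes the Koszul expression a linear form in the value of the last field, which
  -- `sharp` represents; any differentiable `Z` may then replace the extension.
  let L := TensorialAt.mkHom _ _ (hg.tensorialAt_koszul hX hY)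
  have hL : ∀ w : TangentSpace 𝓘(ℝ, E) p, koszul g X Y (ext w) p = L w := fun w ↦
    (TensorialAt.mkHom_apply_eq_extend (hg.tensorialAt_koszul hX hY) w).symm
  let α : TangentSpace 𝓘(ℝ, E) p →ₗ[ℝ] ℝ := (1 / 2 : ℝ) • L.toLinearMap
  have e : nabla g X Y p = sharp g p α := by
    unfold nabla
    congr 1
    ext w
    simp [hL, α]; ring
  rw [e, hg.sharp_left]
  simp [α, L, TensorialAt.mkHom_apply (hg.tensorialAt_koszul hX hY) hZ]
  ring

end IsMetric
end LeviCivita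

/-! ### Regularity of derivatives, and the axioms of the Levi-Civita connection. -/

section Connection

variable {E : Type*} [NormedAddCommGroup E] [NormedSpace ℝ E] [FiniteDimensional ℝ E]
  {M : Type*} [TopologicalSpace M] [ChartedSpace E M] [IsManifold 𝓘(ℝ, E) ∞ M]

lemma contMDiffAt_ext {p : M} (v : TangentSpace 𝓘(ℝ, E) p) : CMDiffAt 2 (T% (ext v)) p :=
  have : IsManifold 𝓘(ℝ, E) (2 + 1) M := IsManifold.of_le (n := ∞) (by norm_cast)
  FiberBundle.contMDiffAt_extend 𝓘(ℝ, E) E v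

lemma mdiffAt_ext {p : M} (v : TangentSpace 𝓘(ℝ, E) p) : MDiffAt (T% (ext v)) p :=
  FiberBundle.mdifferentiableAt_extend 𝓘(ℝ, E) E v

@[simp]
lemma ext_self {p : M} (v : TangentSpace 𝓘(ℝ, E) p) : ext v p = v :=
  FiberBundle.extend_apply_self E v

lemma dirDeriv_congr {X : VField E M} {f h : M → ℝ} {p : M} (hf : f =ᶠ[𝓝 p] h) :
    dirDeriv X f p = dirDeriv X h p := by
  have e : mfderiv 𝓘(ℝ, E) 𝓘(ℝ, ℝ) f p = mfderiv 𝓘(ℝ, E) 𝓘(ℝ, ℝ) h p := hf.mfderiv_eq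
  exact congrArg (fun L : TangentSpace 𝓘(ℝ, E) p →L[ℝ] ℝ ↦ L (X p)) e

lemma bracket_congr {X X' Y Y' : VField E M} {p : M} (hX : X =ᶠ[𝓝 p] X') (hY : Y =ᶠ[𝓝 p] Y') :
    bracket X Y p = bracket X' Y' p :=
  hX.mlieBracket_vectorField_eq hY

lemma bracket_swap (X Y : VField E M) (p : M) : bracket X Y p = -bracket Y X p :=
  VectorField.mlieBracket_swap_apply

lemma bracket_smul_right {X Y : VField E M} {f : M → ℝ} {p : M} (hf : MDiffAt f p)
    (hY : MDiffAt (T% Y) p) :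
    bracket X (f • Y) p = dirDeriv X f p • Y p + f p • bracket X Y p :=
  VectorField.mlieBracket_smul_right hf hY

lemma bracket_add_right {X Y Z : VField E M} {p : M} (hY : MDiffAt (T% Y) p)
    (hZ : MDiffAt (T% Z) p) : bracket X (Y + Z) p = bracket X Y p + bracket X Z p :=
  VectorField.mlieBracket_add_right hY hZ

lemma mdiffAt_bracket {X Y : VField E M} {p : M} (hX : CMDiffAt 2 (T% X) p)
    (hY : CMDiffAt 2 (T% Y) p) : MDiffAt (T% (bracket X Y)) p := by
  have : IsManifold 𝓘(ℝ, E) ((2 : ℕ∞) + 1) M := IsManifold.of_le (n := ∞) (by norm_cast)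
  have : IsManifold 𝓘(ℝ, E) (minSmoothness ℝ 2) M :=
    IsManifold.of_le (n := ∞) (by simp; norm_cast)
  have h := ContMDiffAt.mlieBracket_vectorField (m := 1) (n := 2) hX hY
    (by simp; norm_num)
  exact h.mdifferentiableAt one_ne_zero

lemma eventually_mdiffAt {X : VField E M} {p : M} (hX : CMDiffAt 2 (T% X) p) :
    ∀ᶠ q in 𝓝 p, MDiffAt (T% X) q := by
  have : IsManifold 𝓘(ℝ, E) (2 + 1) M := IsManifold.of_le (n := ∞) (by norm_cast)
  exact ((contMDiffAt_iff_contMDiffAt_nhds (by decide)).1 hX).mono fun q hq ↦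
    hq.mdifferentiableAt two_ne_zero

lemma eventually_mdiffAt_fun {f : M → ℝ} {p : M} (hf : CMDiffAt 2 f p) :
    ∀ᶠ q in 𝓝 p, MDiffAt f q := by
  have : IsManifold 𝓘(ℝ, E) 2 M := IsManifold.of_le (n := ∞) (by norm_cast)
  exact ((contMDiffAt_iff_contMDiffAt_nhds (by decide)).1 hf).mono fun q hq ↦
    hq.mdifferentiableAt two_ne_zero

/-- For a local frame field `W`, `Xf` is the coefficient of `W` in `[X, fW] - f[X, W]`, so its
differentiability follows from that of brackets of `C²` fields. -/
lemma mdiffAt_dirDeriv [Nontrivial E] {X : VField E M} {f : M → ℝ} {p : M}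
    (hX : CMDiffAt 2 (T% X) p) (hf : CMDiffAt 2 f p) : MDiffAt (dirDeriv X f) p := by
  have : IsManifold 𝓘(ℝ, E) (2 + 1) M := IsManifold.of_le (n := ∞) (by norm_cast)
  let b := Module.finBasis ℝ E
  obtain ⟨i⟩ : Nonempty (Fin (Module.finrank ℝ E)) := ⟨⟨0, Module.finrank_pos⟩⟩
  let t := trivializationAt E (TangentSpace 𝓘(ℝ, E)) p
  have hp : p ∈ t.baseSet := FiberBundle.mem_baseSet_trivializationAt' p
  let W : VField E M := t.localFrame b i
  have hW : CMDiffAt 2 (T% W) p := contMDiffAt_localFrame_of_mem 2 t b i hp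
  have hfW : CMDiffAt 2 (T% (f • W)) p := hf.smul_section hW
  let Z : VField E M := bracket X (f • W) - f • bracket X W
  have hZ : MDiffAt (T% Z) p :=
    mdifferentiableAt_sub_section (mdiffAt_bracket hX hfW)
      ((hf.mdifferentiableAt two_ne_zero).smul_section (mdiffAt_bracket hX hW))
  refine (mdifferentiableAt_localFrameCoeff (e := t) b hp hZ i).congr_of_eventuallyEq ?_
  filter_upwards [eventually_mdiffAt hW, eventually_mdiffAt_fun hf, t.open_baseSet.mem_nhds hp]
    with q hq hfq hqt
  have e : Z q = dirDeriv X f q • W q := by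
    change bracket X (f • W) q - f q • bracket X W q = _
    rw [bracket_smul_right hfq hq, add_sub_cancel_right]
  have e1 : t.localFrameCoeff 𝓘(ℝ, E) b i q (W q) = 1 := by
    rw [t.localFrameCoeff_apply_of_mem_baseSet b hqt W]
    simp [W, hqt]
  simp [LinearMap.piApply, e, e1]

/-- The commutator of derivations along two vector fields is the derivation along the bracket. -/
lemma dirDeriv_bracket [Nontrivial E] {X Y : VField E M} {f : M → ℝ} {p : M}
    (hX : CMDiffAt 2 (T% X) p) (hY : CMDiffAt 2 (T% Y) p) (hf : CMDiffAt 2 f p) :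
    dirDeriv (bracket X Y) f p = dirDeriv X (dirDeriv Y f) p - dirDeriv Y (dirDeriv X f) p := by
  have : IsManifold 𝓘(ℝ, E) (minSmoothness ℝ 3) M :=
    IsManifold.of_le (n := ∞) (by simp; norm_cast)
  -- The Jacobi identity for `X, Y, fW` minus `f` times that for `X, Y, W` leaves a multiple of
  -- `W(p) ≠ 0`, whose coefficient is the claimed difference.
  obtain ⟨w, hw⟩ : ∃ w : TangentSpace 𝓘(ℝ, E) p, w ≠ 0 := exists_ne (0 : E)
  let W : VField E M := ext w
  have hW : CMDiffAt 2 (T% W) p := contMDiffAt_ext w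
  have hfW : CMDiffAt 2 (T% (f • W)) p := hf.smul_section hW
  have jacobi : ∀ V : VField E M, CMDiffAt 2 (T% V) p → bracket X (bracket Y V) p
      = bracket (bracket X Y) V p + bracket Y (bracket X V) p := fun V hV ↦
    VectorField.leibniz_identity_mlieBracket_apply (by simpa using hX) (by simpa using hY)
      (by simpa using hV)
  have hf1 : MDiffAt f p := hf.mdifferentiableAt two_ne_zero
  have hW1 : MDiffAt (T% W) p := hW.mdifferentiableAt two_ne_zero
  have expand : ∀ A B : VField E M, CMDiffAt 2 (T% A) p → CMDiffAt 2 (T% B) p →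
      bracket A (bracket B (f • W)) p = dirDeriv A (dirDeriv B f) p • w
        + dirDeriv B f p • bracket A W p + dirDeriv A f p • bracket B W p
        + f p • bracket A (bracket B W) p := by
    intro A B hA hB
    have e : bracket B (f • W) =ᶠ[𝓝 p] (dirDeriv B f) • W + f • bracket B W := by
      filter_upwards [eventually_mdiffAt hW, eventually_mdiffAt_fun hf] with q hq hfq
      exact bracket_smul_right hfq hq
    have hBf := mdiffAt_dirDeriv hB hf
    have hBW := mdiffAt_bracket hB hW
    rw [bracket_congr (EventuallyEq.refl (𝓝 p) A) e, bracket_add_right (hBf.smul_section hW1)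
      (hf1.smul_section hBW), bracket_smul_right hBf hW1, bracket_smul_right hf1 hBW]
    simp only [W, ext_self]
    abel
  have h := jacobi _ hfW
  rw [expand X Y hX hY, expand Y X hY hX, bracket_smul_right hf1 hW1, jacobi W hW] at h
  simp only [W, ext_self] at h
  have h' : (dirDeriv (bracket X Y) f p
      - (dirDeriv X (dirDeriv Y f) p - dirDeriv Y (dirDeriv X f) p)) • w = 0 := by
    rw [sub_smul, sub_smul]
    rw [smul_add, ← sub_eq_zero] at h
    rw [← neg_eq_zero, ← h]
    abel
  exact sub_eq_zero.1 ((smul_eq_zero.1 h').resolve_right hw)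

/-- Locality: formulas for `∇_B Z` valid near `p` may be substituted inside a second covariant
derivative. -/
lemma nabla_congr_right {g : Form2 E M} {X Y Y' : VField E M} {p : M} (h : Y =ᶠ[𝓝 p] Y') :
    nabla g X Y p = nabla g X Y' p := by
  have key : ∀ w : VField E M, koszul g X Y w p = koszul g X Y' w p := by
    intro w
    have h1 : dirDeriv X (fun q ↦ g q (Y q) (w q)) p = dirDeriv X (fun q ↦ g q (Y' q) (w q)) p :=
      dirDeriv_congr (h.mono fun q hq ↦ by simp only [hq])
    have h2 : dirDeriv w (fun q ↦ g q (X q) (Y q)) p = dirDeriv w (fun q ↦ g q (X q) (Y' q)) p :=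
      dirDeriv_congr (h.mono fun q hq ↦ by simp only [hq])
    simp only [koszul, h1, h2, bracket_congr (EventuallyEq.refl (𝓝 p) X) h,
      bracket_congr h (EventuallyEq.refl (𝓝 p) w)]
    simp only [dirDeriv, h.self_of_nhds]
  simp only [nabla, key]

/-! ### Differentiability of inverse matrices. -/

section Matrix
variable {ι : Type} [Fintype ι] [DecidableEq ι]

lemma mdiffAt_sum {κ : Type} (s : Finset κ) {f : κ → M → ℝ} {p : M}
    (hf : ∀ i ∈ s, MDiffAt (f i) p) : MDiffAt (fun q ↦ ∑ i ∈ s, f i q) p := by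
  have h := MDifferentiableAt.sum (I := 𝓘(ℝ, E)) (E' := ℝ) (t := s) (f := f) (z := p) hf
  rwa [show (∑ i ∈ s, f i) = fun q ↦ ∑ i ∈ s, f i q from
    funext fun q ↦ Finset.sum_apply q s f] at h

lemma mdiffAt_det {A : M → Matrix ι ι ℝ} {p : M} (hA : ∀ i j, MDiffAt (fun q ↦ A q i j) p) :
    MDiffAt (fun q ↦ (A q).det) p := by
  simp only [Matrix.det_apply]
  refine mdiffAt_sum _ fun σ _ ↦ ?_
  have h := MDifferentiableAt.prod (I := 𝓘(ℝ, E)) (F' := ℝ) (t := Finset.univ)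
    (f := fun i q ↦ A q (σ i) i) (z := p) fun i _ ↦ hA (σ i) i
  rw [show (∏ i, fun q ↦ A q (σ i) i) = fun q ↦ ∏ i, A q (σ i) i from
    funext fun q ↦ Finset.prod_apply q _ _] at h
  have e : (fun q ↦ Equiv.Perm.sign σ • ∏ i, A q (σ i) i)
      = (((Equiv.Perm.sign σ : ℤ) : ℝ)) • fun q ↦ ∏ i, A q (σ i) i := by
    ext q; simp [Units.smul_def]
  rw [e]
  exact h.const_smul _

/-- Cramer's rule: the inverse is the adjugate divided by the determinant. -/
lemma mdiffAt_inv_apply {A : M → Matrix ι ι ℝ} {p : M} (hA : ∀ i j, MDiffAt (fun q ↦ A q i j) p)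
    (hdet : (A p).det ≠ 0) (i j : ι) : MDiffAt (fun q ↦ (A q)⁻¹ i j) p := by
  have h1 : MDiffAt (fun q ↦ ((A q).det)⁻¹) p :=
    DifferentiableAt.comp_mdifferentiableAt (g := fun x : ℝ ↦ x⁻¹) (f := fun q ↦ (A q).det)
      (differentiableAt_inv hdet) (mdiffAt_det hA)
  have h2 : MDiffAt (fun q ↦ (A q).adjugate i j) p := by
    simp only [Matrix.adjugate_apply]
    refine mdiffAt_det fun a b ↦ ?_
    by_cases h : a = j
    · subst h
      simpa using mdifferentiableAt_const
    · simpa [Matrix.updateRow_ne h] using hA a b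
  refine (h1.mul h2).congr_of_eventuallyEq (Eventually.of_forall fun q ↦ ?_)
  simp [Matrix.inv_def]

end Matrix

/-! ### Torsion-freeness, metric compatibility, Leibniz rule, regularity of `∇_X Y`. -/

namespace IsMetric
variable {g : Form2 E M} (hg : IsMetric g)
include hg

lemma nabla_left_ext {X Y : VField E M} {p : M} (hX : MDiffAt (T% X) p) (hY : MDiffAt (T% Y) p)
    (z : TangentSpace 𝓘(ℝ, E) p) : g p (nabla g X Y p) z = koszul g X Y (ext z) p / 2 := by
  simpa using hg.nabla_left hX hY (mdiffAt_ext z)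

lemma neg_left (p : M) (x z : TangentSpace 𝓘(ℝ, E) p) : g p (-x) z = -g p x z := by
  rw [← neg_one_smul ℝ x, hg.smul_left]; ring

lemma sub_left (p : M) (x y z : TangentSpace 𝓘(ℝ, E) p) : g p (x - y) z = g p x z - g p y z := by
  rw [sub_eq_add_neg, hg.add_left, hg.neg_left]; ring

lemma sub_right (p : M) (x y z : TangentSpace 𝓘(ℝ, E) p) : g p z (x - y) = g p z x - g p z y := by
  rw [hg.symm, hg.sub_left, hg.symm p x, hg.symm p y]

/-- The Levi-Civita connection is torsion free. -/
lemma nabla_sub_nabla {X Y : VField E M} {p : M} (hX : MDiffAt (T% X) p)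
    (hY : MDiffAt (T% Y) p) : nabla g X Y p - nabla g Y X p = bracket X Y p := by
  refine hg.ext_of_left fun z ↦ ?_
  have hz := mdiffAt_ext (E := E) z
  rw [hg.sub_left, hg.nabla_left_ext hX hY, hg.nabla_left_ext hY hX]
  have h : g p (bracket X Y p) z = g p (bracket X Y p) (ext z p) := by simp
  rw [h]
  simp only [koszul, bracket_swap Y X, hg.neg_left]
  rw [show (fun q ↦ g q (Y q) (X q)) = fun q ↦ g q (X q) (Y q) from funext fun q ↦ hg.symm q _ _]
  ring

/-- The Levi-Civita connection is compatible with the metric. -/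
lemma dirDeriv_metric {X Y Z : VField E M} {p : M} (hX : MDiffAt (T% X) p)
    (hY : MDiffAt (T% Y) p) (hZ : MDiffAt (T% Z) p) :
    dirDeriv X (fun q ↦ g q (Y q) (Z q)) p
      = g p (nabla g X Y p) (Z p) + g p (Y p) (nabla g X Z p) := by
  rw [hg.symm p (Y p), hg.nabla_left hX hY hZ, hg.nabla_left hX hZ hY]
  simp only [koszul, bracket_swap Z Y, hg.neg_left]
  rw [show (fun q ↦ g q (Z q) (Y q)) = fun q ↦ g q (Y q) (Z q) from funext fun q ↦ hg.symm q _ _]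
  ring

/-- The Levi-Civita connection is a tensor in its first argument. -/
lemma nabla_congr_left {X X' Y : VField E M} {p : M} (hX : MDiffAt (T% X) p)
    (hX' : MDiffAt (T% X') p) (hY : MDiffAt (T% Y) p) (h : X p = X' p) :
    nabla g X Y p = nabla g X' Y p := by
  refine hg.ext_of_left fun z ↦ ?_
  rw [hg.nabla_left_ext hX hY, hg.nabla_left_ext hX' hY]
  rw [(hg.tensorialAt_koszul_left hY (mdiffAt_ext z)).pointwise hX hX' h]

/-- Read off from metric compatibility against `w`: both `X g(Y, w)` and `g(Y, ∇_X w)` are additive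
in `Y`. -/
lemma nabla_add_right {X Y Z : VField E M} {p : M} (hX : MDiffAt (T% X) p)
    (hY : MDiffAt (T% Y) p) (hZ : MDiffAt (T% Z) p) :
    nabla g X (Y + Z) p = nabla g X Y p + nabla g X Z p := by
  refine hg.ext_of_left fun w ↦ ?_
  have hw := mdiffAt_ext (E := E) w
  have hYZ : MDiffAt (T% (Y + Z)) p := mdifferentiableAt_add_section hY hZ
  have e := hg.dirDeriv_metric hX hYZ hw
  have e1 := hg.dirDeriv_metric hX hY hw
  have e2 := hg.dirDeriv_metric hX hZ hw
  have e3 : dirDeriv X (fun q ↦ g q ((Y + Z) q) (ext w q)) p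
      = dirDeriv X (fun q ↦ g q (Y q) (ext w q)) p
        + dirDeriv X (fun q ↦ g q (Z q) (ext w q)) p := by
    rw [← dirDeriv_add X (hg.mdiffAt hY hw) (hg.mdiffAt hZ hw)]
    congr 1; ext q; exact hg.add_left q _ _ _
  have e4 : g p ((Y + Z) p) (nabla g X (ext w) p)
      = g p (Y p) (nabla g X (ext w) p) + g p (Z p) (nabla g X (ext w) p) := hg.add_left p _ _ _
  simp only [ext_self] at e e1 e2
  rw [hg.add_left]
  linarith

/-- The Leibniz rule for the Levi-Civita connection. -/
lemma nabla_smul_right {X Y : VField E M} {f : M → ℝ} {p : M} (hX : MDiffAt (T% X) p)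
    (hY : MDiffAt (T% Y) p) (hf : MDiffAt f p) :
    nabla g X (f • Y) p = dirDeriv X f p • Y p + f p • nabla g X Y p := by
  refine hg.ext_of_left fun w ↦ ?_
  have hw := mdiffAt_ext (E := E) w
  have hfY : MDiffAt (T% (f • Y)) p := hf.smul_section hY
  have e := hg.dirDeriv_metric hX hfY hw
  have e1 := hg.dirDeriv_metric hX hY hw
  have e3 : dirDeriv X (fun q ↦ g q ((f • Y) q) (ext w q)) p
      = f p * dirDeriv X (fun q ↦ g q (Y q) (ext w q)) p + g p (Y p) (ext w p) * dirDeriv X f p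
      := by
    rw [← dirDeriv_mul X hf (hg.mdiffAt hY hw)]
    congr 1; ext q; exact hg.smul_left q _ _ _
  have e4 : g p ((f • Y) p) (nabla g X (ext w) p) = f p * g p (Y p) (nabla g X (ext w) p) :=
    hg.smul_left p _ _ _
  simp only [ext_self] at e e1 e3
  rw [hg.add_left, hg.smul_left, hg.smul_left]
  linear_combination e3 - e - e4 + f p * e1

lemma mdiffAt_koszul [Nontrivial E] {X Y Z : VField E M} {p : M} (hX : CMDiffAt 2 (T% X) p)
    (hY : CMDiffAt 2 (T% Y) p) (hZ : CMDiffAt 2 (T% Z) p) : MDiffAt (koszul g X Y Z) p := by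
  have h1 := mdiffAt_dirDeriv hX (hg.contMDiffAt hY hZ)
  have h2 := mdiffAt_dirDeriv hY (hg.contMDiffAt hX hZ)
  have h3 := mdiffAt_dirDeriv hZ (hg.contMDiffAt hX hY)
  have h4 := hg.mdiffAt (mdiffAt_bracket hX hY) (hZ.mdifferentiableAt two_ne_zero)
  have h5 := hg.mdiffAt (mdiffAt_bracket hX hZ) (hY.mdifferentiableAt two_ne_zero)
  have h6 := hg.mdiffAt (mdiffAt_bracket hY hZ) (hX.mdifferentiableAt two_ne_zero)
  exact ((((h1.add h2).sub h3).add h4).sub h5).sub h6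

/-- The covariant derivative of a regular vector field is differentiable. -/
lemma mdiffAt_nabla [Nontrivial E] {X Y : VField E M} {p : M} (hX : CMDiffAt 2 (T% X) p)
    (hY : CMDiffAt 2 (T% Y) p) : MDiffAt (T% (nabla g X Y)) p := by
  have : IsManifold 𝓘(ℝ, E) (2 + 1) M := IsManifold.of_le (n := ∞) (by norm_cast)
  -- `tangentBasis` need not vary continuously with the point, so a local frame is used. With `G`
  -- its Gram matrix, the coefficients `c` of `∇_X Y` solve `c G = koszul / 2` near `p`, and
  -- inverting `G` exhibits them as differentiable functions.
  let b := Module.finBasis ℝ E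
  let t := trivializationAt E (TangentSpace 𝓘(ℝ, E) : M → Type _) p
  have hp : p ∈ t.baseSet := FiberBundle.mem_baseSet_trivializationAt' p
  let s : Fin (Module.finrank ℝ E) → VField E M := t.localFrame b
  have hs : ∀ i, ∀ q ∈ t.baseSet, CMDiffAt 2 (T% (s i)) q := fun i q hq ↦
    contMDiffAt_localFrame_of_mem 2 t b i hq
  have hs1 : ∀ i, ∀ q ∈ t.baseSet, MDiffAt (T% (s i)) q := fun i q hq ↦
    (hs i q hq).mdifferentiableAt two_ne_zero
  let G : M → Matrix (Fin (Module.finrank ℝ E)) (Fin (Module.finrank ℝ E)) ℝ := fun q ↦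
    Matrix.of fun i j ↦ g q (s i q) (s j q)
  have hG : ∀ q ∈ t.baseSet, IsUnit (G q).det := fun q hq ↦ by
    have e : G q = Matrix.of fun i j ↦ g q (t.basisAt b hq i) (t.basisAt b hq j) := by
      ext i j; simp [G, s, hq]
    rw [e]
    exact hg.isUnit_det_of_basis _
  rw [mdifferentiableAt_iff_localFrameCoeff b hp]
  intro i
  have hsum : MDiffAt (fun q ↦ ∑ j, (koszul g X Y (s j) q / 2) * (G q)⁻¹ j i) p := by
    refine mdiffAt_sum _ fun j _ ↦ ?_
    have h := (hg.mdiffAt_koszul hX hY (hs j p hp)).mul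
      (mdiffAt_inv_apply (A := G) (fun k l ↦ hg.mdiffAt (hs1 k p hp) (hs1 l p hp))
        (hG p hp).ne_zero j i)
    have h' := h.const_smul (1 / 2 : ℝ)
    refine h'.congr_of_eventuallyEq (Eventually.of_forall fun q ↦ ?_)
    simp; ring
  refine hsum.congr_of_eventuallyEq ?_
  filter_upwards [eventually_mdiffAt hX, eventually_mdiffAt hY, t.open_baseSet.mem_nhds hp]
    with q hXq hYq hq
  let c : Fin (Module.finrank ℝ E) → ℝ := fun j ↦
    t.localFrameCoeff 𝓘(ℝ, E) b j q (nabla g X Y q)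
  have hc : nabla g X Y q = ∑ j, c j • s j q :=
    t.eq_sum_localFrameCoeff_smul (s := nabla g X Y) (b := b) hq
  have hk : Matrix.vecMul c (G q) = fun j ↦ koszul g X Y (s j) q / 2 := by
    ext j
    rw [← hg.nabla_left hXq hYq (hs1 j q hq), hc]
    change _ = hg.bilin q (∑ k, c k • s k q) (s j q)
    simp only [map_sum, map_smul, LinearMap.sum_apply, LinearMap.smul_apply, smul_eq_mul]
    rfl
  change c i = _
  have e : Matrix.vecMul (fun j ↦ koszul g X Y (s j) q / 2) (G q)⁻¹ = c := by
    rw [← hk, Matrix.vecMul_vecMul, Matrix.mul_nonsing_inv _ (hG q hq), Matrix.vecMul_one]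
  rw [← e]
  rfl

end IsMetric
end Connection

/-! ### Second covariant derivatives and skew-symmetry of the curvature operator. -/

section Curvature

variable {E : Type*} [NormedAddCommGroup E] [NormedSpace ℝ E] [FiniteDimensional ℝ E]
  {M : Type*} [TopologicalSpace M] [ChartedSpace E M] [IsManifold 𝓘(ℝ, E) ∞ M]

/-- Differentiability of a vector field at a point. -/
abbrev VDiffAt (X : VField E M) (p : M) : Prop := MDiffAt (T% X) p

/-- Regularity of class `C²` of a vector field at a point. -/
abbrev VC2At (X : VField E M) (p : M) : Prop := CMDiffAt 2 (T% X) p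

namespace IsMetric
variable {g : Form2 E M} (hg : IsMetric g)
include hg

lemma dirDeriv_dirDeriv_metric [Nontrivial E] {X Y Z W : VField E M} {p : M}
    (hX : CMDiffAt 2 (T% X) p) (hY : CMDiffAt 2 (T% Y) p) (hZ : CMDiffAt 2 (T% Z) p)
    (hW : CMDiffAt 2 (T% W) p) :
    dirDeriv X (dirDeriv Y (fun q ↦ g q (Z q) (W q))) p
      = g p (nabla g X (nabla g Y Z) p) (W p) + g p (nabla g Y Z p) (nabla g X W p)
        + (g p (nabla g X Z p) (nabla g Y W p) + g p (Z p) (nabla g X (nabla g Y W) p)) := by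
  have hX1 := hX.mdifferentiableAt two_ne_zero
  have hZ1 := hZ.mdifferentiableAt two_ne_zero
  have hW1 := hW.mdifferentiableAt two_ne_zero
  have e : dirDeriv Y (fun q ↦ g q (Z q) (W q)) =ᶠ[𝓝 p]
      fun q ↦ g q (nabla g Y Z q) (W q) + g q (Z q) (nabla g Y W q) := by
    filter_upwards [eventually_mdiffAt hY, eventually_mdiffAt hZ, eventually_mdiffAt hW]
      with q h1 h2 h3
    exact hg.dirDeriv_metric h1 h2 h3
  have hZ2 := hg.mdiffAt_nabla hY hZ
  have hW2 := hg.mdiffAt_nabla hY hW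
  rw [dirDeriv_congr e, dirDeriv_add X (hg.mdiffAt hZ2 hW1) (hg.mdiffAt hZ1 hW2),
    hg.dirDeriv_metric hX1 hZ2 hW1, hg.dirDeriv_metric hX1 hZ1 hW2]

/-- The curvature operator is skew-symmetric. -/
lemma curvature_skew [Nontrivial E] {X Y Z W : VField E M} {p : M}
    (hX : CMDiffAt 2 (T% X) p) (hY : CMDiffAt 2 (T% Y) p) (hZ : CMDiffAt 2 (T% Z) p)
    (hW : CMDiffAt 2 (T% W) p) :
    g p (curvature g X Y Z p) (W p) = -g p (Z p) (curvature g X Y W p) := by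
  -- In `X(Y g(Z,W)) - Y(X g(Z,W)) = [X,Y] g(Z,W)` the mixed first-order terms are symmetric in `X,
  -- Y` and cancel.
  have h1 := hg.dirDeriv_dirDeriv_metric hX hY hZ hW
  have h2 := hg.dirDeriv_dirDeriv_metric hY hX hZ hW
  have h3 := hg.dirDeriv_metric (mdiffAt_bracket hX hY) (hZ.mdifferentiableAt two_ne_zero)
    (hW.mdifferentiableAt two_ne_zero)
  have h4 := dirDeriv_bracket hX hY (hg.contMDiffAt hZ hW)
  have e : ∀ V : VField E M, curvature g X Y V p = nabla g X (nabla g Y V) p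
    - nabla g Y (nabla g X V) p - nabla g (bracket X Y) V p := fun V ↦ rfl
  rw [e, e, hg.sub_left, hg.sub_left, hg.sub_right, hg.sub_right]
  linarith

lemma nabla_neg_right {X Y : VField E M} {p : M} (hX : MDiffAt (T% X) p)
    (hY : MDiffAt (T% Y) p) : nabla g X (-Y) p = -nabla g X Y p := by
  have h := hg.nabla_smul_right (f := fun _ ↦ (-1 : ℝ)) hX hY mdifferentiableAt_const
  rw [show (fun _ : M ↦ (-1 : ℝ)) • Y = -Y from funext fun q ↦ neg_one_smul ℝ (Y q)] at h
  rw [h]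
  simp [dirDeriv, mvfderiv_const]

lemma nabla_zero_right {X : VField E M} {p : M} (hX : MDiffAt (T% X) p) :
    nabla g X 0 p = 0 := by
  have h0 : MDiffAt (T% (0 : VField E M)) p := Bundle.mdifferentiable_zeroSection ℝ _ p
  have h := hg.nabla_add_right hX h0 h0
  rw [add_zero] at h
  simpa using h

end IsMetric
end Curvature

/-! ### Algebra of accR structures; both B-metrics are metrics. -/

namespace AccRStructure

variable {n : ℕ} {M : Type*} [TopologicalSpace M] [ChartedSpace (Model n) M]
  [IsManifold 𝓘(ℝ, Model n) ∞ M] (S : AccRStructure n M)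

instance : Nontrivial (Model n) :=
  Module.nontrivial_of_finrank_pos (R := ℝ) (by simp)

lemma g_ξ_right (p : M) (x : TangentSpace 𝓘(ℝ, Model n) p) : S.g p x (S.ξ p) = S.η p x := by
  have h := S.g_φ_φ p x (S.ξ p)
  rw [S.φ_ξ, S.η_ξ, map_zero] at h
  linarith

lemma g_ξ_left (p : M) (x : TangentSpace 𝓘(ℝ, Model n) p) : S.g p (S.ξ p) x = S.η p x := by
  rw [S.g_symm, S.g_ξ_right]

lemma g_φ_left (p : M) (x y : TangentSpace 𝓘(ℝ, Model n) p) :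
    S.g p (S.φ p x) y = S.g p x (S.φ p y) := by
  have h := S.g_φ_φ p x (S.φ p y)
  rw [S.φ_φ, S.η_φ, map_add, map_neg, map_smul, S.g_ξ_right, S.η_φ] at h
  simp at h
  linarith

lemma g_nondeg (p : M) (x : TangentSpace 𝓘(ℝ, Model n) p) (h : ∀ y, S.g p x y = 0) : x = 0 := by
  obtain ⟨b, hb, hl, hr⟩ := S.g_signature p
  rw [← b.sum_repr x]
  refine Finset.sum_eq_zero fun i _ ↦ ?_
  have hi := h (b i)
  rw [← b.sum_repr x, map_sum, sum_apply, Finset.sum_eq_single i] at hi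
  · rcases i with i | i
    · simp [hl] at hi; simp [hi]
    · simp [hr] at hi; simp [hi]
  · intro j _ hj; simp [hb j i hj]
  · simp

lemma mdiffAt_φ {X : VField (Model n) M} {p : M} (hX : VDiffAt X p) :
    VDiffAt (E := Model n) (fun q ↦ S.φ q (X q)) p :=
  ((S.smooth_φ p).mdifferentiableAt (by simp)).clm_bundle_apply hX

lemma contMDiffAt_φ {X : VField (Model n) M} {p : M} (hX : VC2At X p) :
    VC2At (E := Model n) (fun q ↦ S.φ q (X q)) p :=
  ((S.smooth_φ p).of_le (by norm_cast)).clm_bundle_apply hX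

lemma contMDiffAt_ξ (p : M) : VC2At S.ξ p := (S.smooth_ξ p).of_le (by norm_cast)

lemma mdiffAt_ξ (p : M) : VDiffAt S.ξ p := (S.smooth_ξ p).mdifferentiableAt (by simp)

/-- The B-metric is a metric. -/
lemma isMetric : IsMetric S.metric where
  add_left p x y z := by simp [metric]
  smul_left p a x z := by simp [metric]
  symm := S.g_symm
  nondeg := S.g_nondeg
  mdiffAt {X Y p} hX hY := by
    have h := ((S.smooth_g p).mdifferentiableAt (by simp)).clm_bundle_apply₂
      (E₃ := Bundle.Trivial M ℝ) hX hY
    rw [mdifferentiableAt_totalSpace] at h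
    exact h.2
  contMDiffAt {X Y p} hX hY := by
    have h := ContMDiffAt.clm_bundle_apply₂ (E₃ := Bundle.Trivial M ℝ)
      ((S.smooth_g p).of_le (by norm_cast)) hX hY
    rw [Bundle.contMDiffAt_totalSpace] at h
    exact h.2

lemma mdiffAt_η {X : VField (Model n) M} {p : M} (hX : VDiffAt X p) :
    MDifferentiableAt 𝓘(ℝ, Model n) 𝓘(ℝ, ℝ) (fun q ↦ S.η q (X q)) p := by
  have h := S.isMetric.mdiffAt hX (S.mdiffAt_ξ p)
  simpa only [metric, S.g_ξ_right] using h

lemma contMDiffAt_η {X : VField (Model n) M} {p : M} (hX : VC2At X p) :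
    ContMDiffAt 𝓘(ℝ, Model n) 𝓘(ℝ, ℝ) 2 (fun q ↦ S.η q (X q)) p := by
  have h := S.isMetric.contMDiffAt hX (S.contMDiffAt_ξ p)
  simpa only [metric, S.g_ξ_right] using h

/-- `g̃` is `g` composed with `φ + η ⊗ ξ`, whose inverse is `-φ + η ⊗ ξ`; nondegeneracy thus passes
from `g` to `g̃`. -/
lemma assocMetric_φ_right (p : M) (x y : TangentSpace 𝓘(ℝ, Model n) p) :
    S.assocMetric p x (-S.φ p y + S.η p y • S.ξ p) = S.g p x y := by
  simp [assocMetric, S.φ_φ, S.φ_ξ, S.η_φ, S.η_ξ, S.g_ξ_right]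
  ring

lemma assocMetric_symm (p : M) (x y : TangentSpace 𝓘(ℝ, Model n) p) :
    S.assocMetric p x y = S.assocMetric p y x := by
  rw [assocMetric, assocMetric, ← S.g_φ_left, S.g_symm, mul_comm (S.η p x)]

/-- The associated B-metric is a metric. -/
lemma isMetric_assocMetric : IsMetric S.assocMetric where
  add_left p x y z := by simp [assocMetric]; ring
  smul_left p a x z := by simp [assocMetric]; ring
  symm := S.assocMetric_symm
  nondeg p x h := S.g_nondeg p x fun y ↦ by rw [← S.assocMetric_φ_right, h]
  mdiffAt hX hY :=
    (S.isMetric.mdiffAt hX (S.mdiffAt_φ hY)).add ((S.mdiffAt_η hX).mul (S.mdiffAt_η hY))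
  contMDiffAt hX hY :=
    (S.isMetric.contMDiffAt hX (S.contMDiffAt_φ hY)).add
      ((S.contMDiffAt_η hX).mul (S.contMDiffAt_η hY))

end AccRStructure

/-! ### Sasaki-like structures: derivatives of `φ`, `ξ`, `η`, `g̃`, and the connection of `g̃`. -/

namespace AccRStructure

variable {n : ℕ} {M : Type*} [TopologicalSpace M] [ChartedSpace (Model n) M]
  [IsManifold 𝓘(ℝ, Model n) ∞ M] (S : AccRStructure n M)

/-- The vector field `φX`. -/
def phiField (X : VField (Model n) M) : VField (Model n) M := fun q ↦ S.φ q (X q)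

/-- The symmetric form `g(φx,φy) - g(x,φy)`, which measures the difference between the Levi-Civita
connections of `g̃` and `g` on a Sasaki-like manifold. -/
def defect (p : M) (x y : TangentSpace 𝓘(ℝ, Model n) p) : ℝ :=
  S.g p (S.φ p x) (S.φ p y) - S.g p x (S.φ p y)

lemma g_φφ_left (p : M) (x y : TangentSpace 𝓘(ℝ, Model n) p) :
    S.g p (S.φ p (S.φ p x)) y = S.g p (S.φ p x) (S.φ p y) := S.g_φ_left p _ _

lemma φ_symm (p : M) (x y : TangentSpace 𝓘(ℝ, Model n) p) :
    S.g p x (S.φ p y) = S.g p y (S.φ p x) := by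
  rw [← S.g_φ_left, S.g_symm]

lemma mdiffAt_phiField {X : VField (Model n) M} {p : M} (hX : VDiffAt X p) :
    VDiffAt (S.phiField X) p := S.mdiffAt_φ hX

lemma mdiffAt_defect {X Y : VField (Model n) M} {p : M} (hX : VDiffAt X p) (hY : VDiffAt Y p) :
    MDifferentiableAt 𝓘(ℝ, Model n) 𝓘(ℝ, ℝ) (fun q ↦ S.defect q (X q) (Y q)) p :=
  (S.isMetric.mdiffAt (S.mdiffAt_phiField hX) (S.mdiffAt_phiField hY)).sub
    (S.isMetric.mdiffAt hX (S.mdiffAt_phiField hY))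

/-- The vector field `(∇_X φ) Y`. -/
def nablaPhi (X Y : VField (Model n) M) : VField (Model n) M :=
  fun q ↦ nabla S.metric X (S.phiField Y) q - S.φ q (nabla S.metric X Y q)

/-- `φ` is self-adjoint and `∇g = 0`, so `∇_X φ` is self-adjoint. The Sasaki-like condition speaks
only of extensions `ext y`; this symmetry moves an arbitrary field `Y` to a slot where only its
value at `p` matters. -/
lemma nablaPhi_symm {X Y Z : VField (Model n) M} {p : M} (hX : VDiffAt X p) (hY : VDiffAt Y p)
    (hZ : VDiffAt Z p) : S.g p (S.nablaPhi X Y p) (Z p) = S.g p (S.nablaPhi X Z p) (Y p) := by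
  have h1 := S.isMetric.dirDeriv_metric hX (S.mdiffAt_phiField hY) hZ
  have h2 := S.isMetric.dirDeriv_metric hX (S.mdiffAt_phiField hZ) hY
  have e : (fun q ↦ S.metric q (S.phiField Y q) (Z q))
      = fun q ↦ S.metric q (S.phiField Z q) (Y q) :=
    funext fun q ↦ by
      simp only [metric, phiField]
      rw [S.g_φ_left, S.g_symm]
  rw [e, h2] at h1
  simp only [metric, phiField, S.g_φ_left] at h1
  simp only [nablaPhi, map_sub, sub_apply, S.g_φ_left]
  rw [S.g_symm p (Z p), S.g_symm p (Y p), S.g_φ_left, S.g_φ_left] at h1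
  linarith

variable {S} in
/-- The covariant derivative of `φ` on a Sasaki-like manifold, for arbitrary vector fields. -/
lemma IsSasakiLike.nablaPhi_eq (hS : S.IsSasakiLike) {X Y : VField (Model n) M} {p : M}
    (hX : VDiffAt X p) (hY : VDiffAt Y p) :
    S.nablaPhi X Y p = S.g p (S.φ p (X p)) (S.φ p (Y p)) • S.ξ p
      + S.η p (Y p) • S.φ p (S.φ p (X p)) := by
  refine S.isMetric.ext_of_left fun z ↦ ?_
  have hz : VDiffAt (ext z) p := mdiffAt_ext z
  have h1 := S.nablaPhi_symm hX hY hz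
  have e : S.nablaPhi X (ext z) p = S.nablaPhi (ext (X p)) (ext z) p := by
    have hX' : VDiffAt (ext (X p)) p := mdiffAt_ext _
    simp only [nablaPhi]
    rw [S.isMetric.nabla_congr_left hX hX' hz (by simp),
      S.isMetric.nabla_congr_left hX hX' (S.mdiffAt_phiField hz) (by simp)]
  have h2 : S.g p (S.nablaPhi (ext (X p)) (ext z) p) (Y p) = _ := hS p (X p) z (Y p)
  rw [ext_self, e, h2] at h1
  change S.g p _ z = S.g p _ z
  rw [h1]
  simp [S.g_ξ_left, S.g_φφ_left]
  ring

variable {S} in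
/-- On a Sasaki-like manifold `∇_X ξ = -φX`. -/
lemma IsSasakiLike.nabla_ξ (hS : S.IsSasakiLike) {X : VField (Model n) M} {p : M}
    (hX : VDiffAt X p) : nabla S.metric X S.ξ p = -S.φ p (X p) := by
  have hξ := S.mdiffAt_ξ p
  -- Since `φξ = 0`, this reads `-φ(∇_X ξ) = φ²X`. Applying `φ` determines `∇_X ξ` up to its
  -- `ξ`-component, which vanishes because `g(ξ,ξ) = 1`.
  have h := hS.nablaPhi_eq hX hξ
  have e0 : S.phiField S.ξ = 0 := funext fun q ↦ S.φ_ξ q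
  rw [nablaPhi, e0, S.isMetric.nabla_zero_right hX, S.φ_ξ, S.η_ξ, map_zero] at h
  have h1 := S.isMetric.dirDeriv_metric hX hξ hξ
  have e1 : (fun q ↦ S.metric q (S.ξ q) (S.ξ q)) = fun _ ↦ (1 : ℝ) :=
    funext fun q ↦ by simp [metric, S.g_ξ_left, S.η_ξ]
  have hη : S.η p (nabla S.metric X S.ξ p) = 0 := by
    rw [e1, dirDeriv, mvfderiv_const] at h1
    simp only [metric, S.g_ξ_left, S.g_ξ_right, zero_apply] at h1
    linarith
  have h2 := congrArg (S.φ p) h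
  simp [S.φ_φ, hη, S.φ_ξ] at h2
  exact h2

variable {S} in
lemma IsSasakiLike.dirDeriv_η (hS : S.IsSasakiLike) {X Y : VField (Model n) M} {p : M}
    (hX : VDiffAt X p) (hY : VDiffAt Y p) :
    dirDeriv X (fun q ↦ S.η q (Y q)) p
      = S.η p (nabla S.metric X Y p) - S.g p (X p) (S.φ p (Y p)) := by
  have h := S.isMetric.dirDeriv_metric hX hY (S.mdiffAt_ξ p)
  simp only [metric, S.g_ξ_right] at h
  rw [h, hS.nabla_ξ hX, map_neg, S.φ_symm]
  rfl

variable {S} in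
lemma IsSasakiLike.dirDeriv_g_φ (hS : S.IsSasakiLike) {X Y Z : VField (Model n) M} {p : M}
    (hX : VDiffAt X p) (hY : VDiffAt Y p) (hZ : VDiffAt Z p) :
    dirDeriv X (fun q ↦ S.g q (Y q) (S.φ q (Z q))) p
      = S.g p (nabla S.metric X Y p) (S.φ p (Z p)) + S.g p (Y p) (S.φ p (nabla S.metric X Z p))
        + S.g p (S.φ p (X p)) (S.φ p (Z p)) * S.η p (Y p)
        + S.g p (S.φ p (X p)) (S.φ p (Y p)) * S.η p (Z p) := by
  have h : dirDeriv X (fun q ↦ S.g q (Y q) (S.φ q (Z q))) p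
      = S.g p (nabla S.metric X Y p) (S.φ p (Z p))
        + S.g p (Y p) (nabla S.metric X (S.phiField Z) p) :=
    S.isMetric.dirDeriv_metric hX hY (S.mdiffAt_phiField hZ)
  have h1 : nabla S.metric X (S.phiField Z) p
      = S.φ p (nabla S.metric X Z p) + S.nablaPhi X Z p := by simp [nablaPhi]
  rw [h, h1, hS.nablaPhi_eq hX hZ]
  simp only [map_add, map_smul, S.g_ξ_right, smul_eq_mul]
  rw [← S.g_φ_left p (Y p) (S.φ p (X p)), S.g_symm p (S.φ p (Y p))]
  ring

variable {S} in
-- The two parts of `defect` have different origins: `g(φx,φy)` comes from `∇φ`, and `-g(x,φy)` from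
-- `∇η`.
lemma IsSasakiLike.dirDeriv_assocMetric (hS : S.IsSasakiLike) {X Y Z : VField (Model n) M} {p : M}
    (hX : VDiffAt X p) (hY : VDiffAt Y p) (hZ : VDiffAt Z p) :
    dirDeriv X (fun q ↦ S.assocMetric q (Y q) (Z q)) p
      = S.assocMetric p (nabla S.metric X Y p) (Z p) + S.assocMetric p (Y p) (nabla S.metric X Z p)
        + S.defect p (X p) (Z p) * S.η p (Y p) + S.defect p (X p) (Y p) * S.η p (Z p) := by
  have h : dirDeriv X (fun q ↦ S.assocMetric q (Y q) (Z q)) p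
      = dirDeriv X (fun q ↦ S.g q (Y q) (S.φ q (Z q))) p
        + dirDeriv X (fun q ↦ S.η q (Y q) * S.η q (Z q)) p :=
    dirDeriv_add X (S.isMetric.mdiffAt hY (S.mdiffAt_phiField hZ))
      ((S.mdiffAt_η hY).mul (S.mdiffAt_η hZ))
  rw [h, hS.dirDeriv_g_φ hX hY hZ, dirDeriv_mul X (S.mdiffAt_η hY) (S.mdiffAt_η hZ),
    hS.dirDeriv_η hX hY, hS.dirDeriv_η hX hZ]
  simp only [assocMetric, defect]
  ring

lemma assocMetric_ξ_left (p : M) (x : TangentSpace 𝓘(ℝ, Model n) p) :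
    S.assocMetric p (S.ξ p) x = S.η p x := by
  simp [assocMetric, S.g_ξ_left, S.η_φ, S.η_ξ]

lemma defect_symm (p : M) (x y : TangentSpace 𝓘(ℝ, Model n) p) :
    S.defect p x y = S.defect p y x := by
  rw [defect, defect, S.g_symm p (S.φ p x), S.φ_symm p x y]

lemma defect_ξ_right (p : M) (x : TangentSpace 𝓘(ℝ, Model n) p) : S.defect p x (S.ξ p) = 0 := by
  simp [defect, S.φ_ξ]

variable {S} in
/-- The Levi-Civita connection of the associated metric of a Sasaki-like manifold. -/
lemma IsSasakiLike.nabla_assocMetric (hS : S.IsSasakiLike) {X Y : VField (Model n) M} {p : M}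
    (hX : VDiffAt X p) (hY : VDiffAt Y p) :
    nabla S.assocMetric X Y p = nabla S.metric X Y p + S.defect p (X p) (Y p) • S.ξ p := by
  have hT := S.isMetric_assocMetric
  refine hT.ext_of_left fun z ↦ ?_
  have hz : VDiffAt (ext z) p := mdiffAt_ext z
  -- Once brackets are commutators of `∇`, the six `defect` terms reduce by symmetry to `2 D(X,Y)
  -- η(z)`, and `η(z) = g̃(ξ,z)`.
  rw [hT.nabla_left_ext hX hY, koszul, hS.dirDeriv_assocMetric hX hY hz,
    hS.dirDeriv_assocMetric hY hX hz, hS.dirDeriv_assocMetric hz hX hY,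
    ← S.isMetric.nabla_sub_nabla hX hY, ← S.isMetric.nabla_sub_nabla hX hz,
    ← S.isMetric.nabla_sub_nabla hY hz]
  simp only [hT.add_left, hT.sub_left, hT.smul_left, ext_self, S.assocMetric_ξ_left]
  rw [S.defect_symm p z (Y p), S.defect_symm p z (X p), S.defect_symm p (Y p) (X p),
    S.assocMetric_symm p (Y p) (nabla S.metric X _ p),
    S.assocMetric_symm p (X p) (nabla S.metric _ _ p),
    S.assocMetric_symm p (X p) (nabla S.metric _ _ p)]
  ring

end AccRStructure

/-! ### Traces of endomorphisms and forms; Lie derivatives along `kξ`. -/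

section Trace

/-- A real endomorphism with `T³ = -T` is trace free. -/
lemma trace_eq_zero_of_cube_eq_neg {V : Type*} [AddCommGroup V] [Module ℝ V]
    [FiniteDimensional ℝ V] (T : V →ₗ[ℝ] V) (hT : ∀ x, T (T (T x)) = -T x) :
    LinearMap.trace ℝ V T = 0 := by
  classical
  let b := Module.finBasis ℝ V
  rcases subsingleton_or_nontrivial V with hV | hV
  · rw [Subsingleton.elim T 0, map_zero]
  have : Nonempty (Fin (Module.finrank ℝ V)) := ⟨⟨0, Module.finrank_pos⟩⟩
  rw [LinearMap.trace_eq_matrix_trace ℝ b]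
  set A := LinearMap.toMatrix b b T with hA
  have hcube : A * (A * A) = -A := by
    rw [hA, ← LinearMap.toMatrix_mul, ← LinearMap.toMatrix_mul, ← map_neg]
    congr 1
    ext x
    exact hT x
  -- Complex eigenvalues satisfy `r³ + r = 0`, so they are `0` or `±i`; their sum, the real number
  -- `tr T`, has zero real part.
  let C : Matrix _ _ ℂ := A.map Complex.ofRealHom
  have hC : Polynomial.aeval C (Polynomial.X ^ 3 + Polynomial.X : Polynomial ℂ) = 0 := by
    have : C * (C * C) = -C := by
      simp only [C]
      rw [← Matrix.map_mul, ← Matrix.map_mul, hcube]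
      ext i j; simp
    simp [pow_succ, mul_assoc, this]
  have hroots : ∀ r ∈ C.charpoly.roots, r.re = 0 := by
    intro r hr
    have hr' : r ∈ spectrum ℂ C :=
      Matrix.mem_spectrum_iff_isRoot_charpoly.2 (Polynomial.isRoot_of_mem_roots hr)
    have h := spectrum.subset_polynomial_aeval C (Polynomial.X ^ 3 + Polynomial.X : Polynomial ℂ)
      ⟨r, hr', rfl⟩
    rw [hC, spectrum.zero_eq] at h
    have h' : r * (r ^ 2 + 1) = 0 := by
      have : r ^ 3 + r = 0 := by simpa using h
      linear_combination this
    rcases mul_eq_zero.1 h' with h0 | h0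
    · simp [h0]
    · have hi : r * r = Complex.I * Complex.I := by
        rw [Complex.I_mul_I]; linear_combination h0
      rcases mul_self_eq_mul_self_iff.1 hi with h1 | h1 <;> simp [h1]
  have htr : (A.trace : ℂ) = C.charpoly.roots.sum := by
    rw [← Matrix.trace_eq_sum_roots_charpoly]
    simp [Matrix.trace, C]
  have hre : ∀ s : Multiset ℂ, (∀ r ∈ s, r.re = 0) → s.sum.re = 0 := by
    intro s
    induction s using Multiset.induction_on with
    | empty => simp
    | cons a s ih =>
      intro h
      simp [h a (by simp), ih fun r hr ↦ h r (by simp [hr])]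
  have := hre _ hroots
  rwa [← htr, Complex.ofReal_re] at this

variable {E : Type*} [NormedAddCommGroup E] [NormedSpace ℝ E] [FiniteDimensional ℝ E]
  {M : Type*} [TopologicalSpace M] [ChartedSpace E M] [IsManifold 𝓘(ℝ, E) ∞ M]

instance finiteDimensional_tangentSpace (p : M) : FiniteDimensional ℝ (TangentSpace 𝓘(ℝ, E) p) :=
  inferInstanceAs (FiniteDimensional ℝ E)

lemma dirDeriv_const_mul (X : VField E M) (c : ℝ) {f : M → ℝ} {p : M} (hf : MDiffAt f p) :
    dirDeriv X (fun q ↦ c * f q) p = c * dirDeriv X f p := by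
  rw [dirDeriv_mul X mdifferentiableAt_const hf]
  simp [dirDeriv, mvfderiv_const]

lemma sum_coord_eq_trace {p : M}
    (T : TangentSpace 𝓘(ℝ, E) p →ₗ[ℝ] TangentSpace 𝓘(ℝ, E) p) :
    ∑ i, (tangentBasis p).coord i (T (tangentBasis p i)) = LinearMap.trace ℝ _ T := by
  rw [LinearMap.trace_eq_matrix_trace ℝ (tangentBasis p), Matrix.trace]
  simp [LinearMap.toMatrix_apply]

lemma trace_smulRight {V : Type*} [AddCommGroup V] [Module ℝ V] [FiniteDimensional ℝ V]
    (α : V →ₗ[ℝ] ℝ) (v : V) : LinearMap.trace ℝ V (α.smulRight v) = α v := by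
  simp

/-- With `G` the Gram matrix and `A` the matrix of `T`, the form has matrix `G A`, and `tr (G⁻¹ G A)
= tr A`. -/
lemma IsMetric.metricTrace_eq_trace {g : Form2 E M} (hg : IsMetric g) (p : M)
    (T : TangentSpace 𝓘(ℝ, E) p →ₗ[ℝ] TangentSpace 𝓘(ℝ, E) p) :
    metricTrace g p (fun x y ↦ g p x (T y)) = LinearMap.trace ℝ _ T := by
  let b := tangentBasis (E := E) p
  let A := LinearMap.toMatrix b b T
  have hB : ∀ i j, g p (b i) (T (b j)) = (gram g p * A) i j := by
    intro i j
    have h : T (b j) = ∑ k, A k j • b k := by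
      conv_lhs => rw [← b.sum_repr (T (b j))]
      simp [A, LinearMap.toMatrix_apply]
    rw [h]
    change hg.bilin p (b i) (∑ k, A k j • b k) = _
    simp only [map_sum, map_smul, Matrix.mul_apply, smul_eq_mul]
    exact Finset.sum_congr rfl fun k _ ↦ mul_comm _ _
  have hsymm : (gram g p).transpose = gram g p := by
    ext i j; exact hg.symm p _ _
  have hinv : ∀ i j, (gram g p)⁻¹ i j = (gram g p)⁻¹ j i := by
    intro i j
    rw [← Matrix.transpose_apply ((gram g p)⁻¹), Matrix.transpose_nonsing_inv, hsymm]
  rw [LinearMap.trace_eq_matrix_trace ℝ b]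
  have h1 : metricTrace g p (fun x y ↦ g p x (T y))
      = ((gram g p)⁻¹ * (gram g p * A)).trace := by
    simp only [metricTrace, Matrix.trace, Matrix.diag_apply]
    rw [Finset.sum_comm]
    refine Finset.sum_congr rfl fun j _ ↦ ?_
    rw [Matrix.mul_apply]
    exact Finset.sum_congr rfl fun i _ ↦ by rw [← hB, hinv]
  rw [h1, ← Matrix.mul_assoc, Matrix.nonsing_inv_mul _ (hg.isUnit_gram_det p), Matrix.one_mul]

/-- The Lie derivative of a metric along a multiple `kξ` of a vector field. -/
lemma IsMetric.lieDeriv_smul {g : Form2 E M} (hg : IsMetric g) {k : M → ℝ} {ξ : VField E M} {p : M}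
    (hk : MDifferentiableAt 𝓘(ℝ, E) 𝓘(ℝ, ℝ) k p) (hξ : VDiffAt ξ p)
    (x y : TangentSpace 𝓘(ℝ, E) p) :
    lieDeriv (fun q ↦ k q • ξ q) g p x y
      = k p * (g p (nabla g (ext x) ξ p) y + g p x (nabla g (ext y) ξ p))
        + mvfderiv 𝓘(ℝ, E) k p x * g p (ξ p) y + mvfderiv 𝓘(ℝ, E) k p y * g p x (ξ p) := by
  have hb : ∀ v : TangentSpace 𝓘(ℝ, E) p, bracket (fun q ↦ k q • ξ q) (ext v) p
      = (-mvfderiv 𝓘(ℝ, E) k p v) • ξ p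
        + k p • (nabla g ξ (ext v) p - nabla g (ext v) ξ p) := by
    intro v
    rw [hg.nabla_sub_nabla hξ (mdiffAt_ext v)]
    have h := VectorField.mlieBracket_smul_left (W := ext v) hk hξ
    rw [ext_self] at h
    exact h
  have h1 : dirDeriv (fun q ↦ k q • ξ q) (fun q ↦ g q (ext x q) (ext y q)) p
      = k p * dirDeriv ξ (fun q ↦ g q (ext x q) (ext y q)) p := by
    simp [dirDeriv]
  -- The `∇_ξ` terms from metric compatibility cancel those from the brackets; only `∇ξ` and `dk`
  -- survive.
  rw [lieDeriv, h1, hg.dirDeriv_metric hξ (mdiffAt_ext x) (mdiffAt_ext y), hb, hb]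
  simp only [hg.add_left, hg.add_right, hg.smul_left, hg.smul_right, hg.sub_left, hg.sub_right,
    ext_self]
  ring

end Trace

/-! ### Curvature and Ricci tensors of the two metrics. -/

namespace AccRStructure

variable {n : ℕ} {M : Type*} [TopologicalSpace M] [ChartedSpace (Model n) M]
  [IsManifold 𝓘(ℝ, Model n) ∞ M] {S : AccRStructure n M}

/-- On a Sasaki-like manifold `R(X,Y)ξ = η(Y)X - η(X)Y`. -/
lemma IsSasakiLike.curvature_ξ (hS : S.IsSasakiLike) {X Y : VField (Model n) M} {p : M}
    (hX : VC2At X p) (hY : VC2At Y p) :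
    curvature S.metric X Y S.ξ p = S.η p (Y p) • X p - S.η p (X p) • Y p := by
  have hX1 : VDiffAt X p := hX.mdifferentiableAt two_ne_zero
  have hY1 : VDiffAt Y p := hY.mdifferentiableAt two_ne_zero
  -- As `∇ξ = -φ` and `∇` is torsion free, `R(X,Y)ξ = (∇_Y φ)X - (∇_X φ)Y`.
  have key : ∀ A B : VField (Model n) M, VC2At A p → VC2At B p →
      nabla S.metric A (nabla S.metric B S.ξ) p
        = -(S.nablaPhi A B p + S.φ p (nabla S.metric A B p)) := by
    intro A B hA hB
    have hA1 : VDiffAt A p := hA.mdifferentiableAt two_ne_zero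
    have hB1 : VDiffAt B p := hB.mdifferentiableAt two_ne_zero
    have e : nabla S.metric B S.ξ =ᶠ[𝓝 p] -S.phiField B := by
      filter_upwards [eventually_mdiffAt hB] with q hq
      exact hS.nabla_ξ hq
    rw [nabla_congr_right e, S.isMetric.nabla_neg_right hA1 (S.mdiffAt_phiField hB1)]
    simp [nablaPhi]
  have e : curvature S.metric X Y S.ξ p = nabla S.metric X (nabla S.metric Y S.ξ) p
    - nabla S.metric Y (nabla S.metric X S.ξ) p - nabla S.metric (bracket X Y) S.ξ p := rfl
  rw [e, key X Y hX hY, key Y X hY hX, hS.nabla_ξ (mdiffAt_bracket hX hY),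
    ← S.isMetric.nabla_sub_nabla hX1 hY1, hS.nablaPhi_eq hX1 hY1, hS.nablaPhi_eq hY1 hX1,
    S.g_symm p (S.φ p (Y p))]
  simp only [S.φ_φ, map_sub, smul_add, smul_neg, smul_smul, mul_comm (S.η p (X p))]
  abel

lemma trace_id (p : M) :
    LinearMap.trace ℝ (TangentSpace 𝓘(ℝ, Model n) p) LinearMap.id = 2 * n + 1 := by
  rw [LinearMap.trace_id]
  change ((Module.finrank ℝ (Model n) : ℕ) : ℝ) = _
  simp

/-- On a Sasaki-like manifold `ρ(y,ξ) = 2n η(y)`. -/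
lemma IsSasakiLike.ricci_ξ (hS : S.IsSasakiLike) (p : M) (y : TangentSpace 𝓘(ℝ, Model n) p) :
    S.ρ p y (S.ξ p) = 2 * n * S.η p y := by
  -- `ricci` uses the extension of `ξ p` rather than `ξ`. By skew-symmetry, `g(R(X,Y)Z, W)` depends
  -- on `Z` only through `Z p`, so the two agree.
  have hξ : ∀ X Y : VField (Model n) M, VC2At X p → VC2At Y p →
      curvature S.metric X Y (ext (S.ξ p)) p = S.η p (Y p) • X p - S.η p (X p) • Y p := by
    intro X Y hX hY
    rw [← hS.curvature_ξ hX hY]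
    refine S.isMetric.ext_of_left fun w ↦ ?_
    have hw : VC2At (ext w) p := contMDiffAt_ext w
    have h1 := S.isMetric.curvature_skew hX hY (contMDiffAt_ext (S.ξ p)) hw
    have h2 := S.isMetric.curvature_skew hX hY (S.contMDiffAt_ξ p) hw
    rw [ext_self] at h1 h2
    rw [ext_self] at h1
    rw [h1, h2]
  let T : TangentSpace 𝓘(ℝ, Model n) p →ₗ[ℝ] TangentSpace 𝓘(ℝ, Model n) p :=
    S.η p y • LinearMap.id - (S.η p).toLinearMap.smulRight y
  have hT : S.ρ p y (S.ξ p) = LinearMap.trace ℝ _ T := by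
    rw [← sum_coord_eq_trace (E := Model n) T]
    rw [ρ, ricci]
    refine Finset.sum_congr rfl fun i _ ↦ ?_
    rw [hξ _ _ (contMDiffAt_ext _) (contMDiffAt_ext _)]
    simp [T]
  rw [hT, map_sub, map_smul, trace_id, trace_smulRight]
  simp
  ring

variable (S) in
lemma trace_φ (p : M) : LinearMap.trace ℝ _ (S.φ p).toLinearMap = 0 := by
  refine trace_eq_zero_of_cube_eq_neg _ fun x ↦ ?_
  simp [S.φ_φ, S.φ_ξ]

/-- The curvature of the associated metric of a Sasaki-like manifold. -/
lemma IsSasakiLike.curvature_assocMetric (hS : S.IsSasakiLike) {X Y Z : VField (Model n) M} {p : M}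
    (hX : VC2At X p) (hY : VC2At Y p) (hZ : VC2At Z p) :
    curvature S.assocMetric X Y Z p = curvature S.metric X Y Z p
      + (S.g p (S.φ p (Y p)) (S.φ p (Z p)) * S.η p (X p)
          + S.g p (Y p) (S.φ p (Z p)) * S.η p (X p)
          - S.g p (S.φ p (X p)) (S.φ p (Z p)) * S.η p (Y p)
          - S.g p (X p) (S.φ p (Z p)) * S.η p (Y p)) • S.ξ p
      - S.defect p (Y p) (Z p) • S.φ p (X p) + S.defect p (X p) (Z p) • S.φ p (Y p) := by
  have hX1 : VDiffAt X p := hX.mdifferentiableAt two_ne_zero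
  have hY1 : VDiffAt Y p := hY.mdifferentiableAt two_ne_zero
  have hZ1 : VDiffAt Z p := hZ.mdifferentiableAt two_ne_zero
  -- No term quadratic in `defect` appears, because `defect` vanishes on `ξ`; the `φ` term is `∇_A ξ
  -- = -φA`.
  have key : ∀ A B : VField (Model n) M, VC2At A p → VC2At B p →
      nabla S.assocMetric A (nabla S.assocMetric B Z) p
        = nabla S.metric A (nabla S.metric B Z) p
          + (dirDeriv A (fun q ↦ S.defect q (B q) (Z q)) p
            + S.defect p (A p) (nabla S.metric B Z p)) • S.ξ p
          - S.defect p (B p) (Z p) • S.φ p (A p) := by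
    intro A B hA hB
    have hA1 : VDiffAt A p := hA.mdifferentiableAt two_ne_zero
    have hB1 : VDiffAt B p := hB.mdifferentiableAt two_ne_zero
    let d : M → ℝ := fun q ↦ S.defect q (B q) (Z q)
    have hd : MDifferentiableAt 𝓘(ℝ, Model n) 𝓘(ℝ, ℝ) d p := S.mdiffAt_defect hB1 hZ1
    have hN : VDiffAt (nabla S.metric B Z) p := S.isMetric.mdiffAt_nabla hB hZ
    have hdξ : VDiffAt (d • S.ξ) p := hd.smul_section (S.mdiffAt_ξ p)
    have hV : VDiffAt (nabla S.metric B Z + d • S.ξ) p := mdifferentiableAt_add_section hN hdξ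
    have e : nabla S.assocMetric B Z =ᶠ[𝓝 p] nabla S.metric B Z + d • S.ξ := by
      filter_upwards [eventually_mdiffAt hB, eventually_mdiffAt hZ] with q h1 h2
      exact hS.nabla_assocMetric h1 h2
    have e1 : S.defect p (A p) ((nabla S.metric B Z + d • S.ξ) p)
        = S.defect p (A p) (nabla S.metric B Z p) := by
      simp [defect, S.φ_ξ]
    rw [nabla_congr_right e, hS.nabla_assocMetric hA1 hV, e1,
      S.isMetric.nabla_add_right hA1 hN hdξ, S.isMetric.nabla_smul_right hA1 (S.mdiffAt_ξ p) hd,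
      hS.nabla_ξ hA1]
    simp only [d, smul_neg, add_smul]
    abel
  have hdefect : ∀ A B : VField (Model n) M, VDiffAt A p → VDiffAt B p →
      dirDeriv A (fun q ↦ S.defect q (B q) (Z q)) p
        = S.defect p (nabla S.metric A B p) (Z p) + S.defect p (B p) (nabla S.metric A Z p)
          - (S.g p (S.φ p (A p)) (S.φ p (Z p)) + S.g p (A p) (S.φ p (Z p))) * S.η p (B p)
          - (S.g p (S.φ p (A p)) (S.φ p (B p)) + S.g p (A p) (S.φ p (B p))) * S.η p (Z p) := by
    intro A B hA hB
    -- `D = 2 η ⊗ η - g - g̃`, and the derivatives of all three forms are known.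
    have e : (fun q ↦ S.defect q (B q) (Z q))
        = fun q ↦ (2 * (S.η q (B q) * S.η q (Z q)) + -1 * S.metric q (B q) (Z q))
          + -1 * S.assocMetric q (B q) (Z q) := by
      ext q
      simp only [defect, S.g_φ_φ, metric, assocMetric]
      ring
    have hη : MDifferentiableAt 𝓘(ℝ, Model n) 𝓘(ℝ, ℝ)
        (fun q ↦ S.η q (B q) * S.η q (Z q)) p := (S.mdiffAt_η hB).mul (S.mdiffAt_η hZ1)
    have hg := S.isMetric.mdiffAt hB hZ1
    have hgT := S.isMetric_assocMetric.mdiffAt hB hZ1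
    have hc : ∀ (c : ℝ) {f : M → ℝ}, MDifferentiableAt 𝓘(ℝ, Model n) 𝓘(ℝ, ℝ) f p →
        MDifferentiableAt 𝓘(ℝ, Model n) 𝓘(ℝ, ℝ) (fun q ↦ c * f q) p := fun c _ hf ↦
      hf.const_smul c
    have hadd : MDifferentiableAt 𝓘(ℝ, Model n) 𝓘(ℝ, ℝ) (fun q ↦
        2 * (S.η q (B q) * S.η q (Z q)) + -1 * S.metric q (B q) (Z q)) p :=
      (hc 2 hη).add (hc (-1) hg)
    rw [e, dirDeriv_add A hadd (hc (-1) hgT), dirDeriv_add A (hc 2 hη) (hc (-1) hg),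
      dirDeriv_const_mul A 2 hη, dirDeriv_const_mul A (-1) hg, dirDeriv_const_mul A (-1) hgT,
      dirDeriv_mul A (S.mdiffAt_η hB) (S.mdiffAt_η hZ1),
      hS.dirDeriv_η hA hB, hS.dirDeriv_η hA hZ1, hS.dirDeriv_assocMetric hA hB hZ1,
      S.isMetric.dirDeriv_metric hA hB hZ1]
    simp only [defect, metric, assocMetric, S.g_φ_φ]
    ring
  have e : ∀ G : Form2 (Model n) M, curvature G X Y Z p = nabla G X (nabla G Y Z) p
    - nabla G Y (nabla G X Z) p - nabla G (bracket X Y) Z p := fun G ↦ rfl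
  have hbr : S.defect p (bracket X Y p) (Z p)
      = S.defect p (nabla S.metric X Y p) (Z p) - S.defect p (nabla S.metric Y X p) (Z p) := by
    rw [← S.isMetric.nabla_sub_nabla hX1 hY1]
    simp only [defect, map_sub, sub_apply]
    ring
  rw [e, e, key X Y hX hY, key Y X hY hX, hS.nabla_assocMetric (mdiffAt_bracket hX hY) hZ1,
    hdefect X Y hX1 hY1, hdefect Y X hY1 hX1, hbr, S.g_symm p (S.φ p (Y p)) (S.φ p (X p)),
    S.φ_symm p (Y p) (X p)]
  module

/-- On a Sasaki-like manifold the two B-metrics have the same Ricci tensor. -/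
lemma IsSasakiLike.ricci_assocMetric (hS : S.IsSasakiLike) :
    ricci S.assocMetric = ricci S.metric := by
  ext p y z
  let κ : TangentSpace 𝓘(ℝ, Model n) p →ₗ[ℝ] ℝ :=
    (S.g p (S.φ p z)).toLinearMap ∘ₗ ((S.φ p).toLinearMap + LinearMap.id)
  let δ : TangentSpace 𝓘(ℝ, Model n) p →ₗ[ℝ] ℝ :=
    (S.g p (S.φ p z)).toLinearMap ∘ₗ ((S.φ p).toLinearMap - LinearMap.id)
  -- `T` is the curvature difference as a function of its first argument, with `δ = D(·,z)`. Its
  -- trace is `κ(y) - η(y)κ(ξ) - δ(y) tr φ + δ(φy)`, where `κ(ξ) = 0`, `tr φ = 0` and `δ(φy) =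
  -- -κ(y)`.
  let T : TangentSpace 𝓘(ℝ, Model n) p →ₗ[ℝ] TangentSpace 𝓘(ℝ, Model n) p :=
    κ y • (S.η p).toLinearMap.smulRight (S.ξ p) - S.η p y • κ.smulRight (S.ξ p)
      - δ y • (S.φ p).toLinearMap + δ.smulRight (S.φ p y)
  have hT : LinearMap.trace ℝ _ T = 0 := by
    simp only [T, map_add, map_sub, map_smul, trace_smulRight, S.trace_φ]
    simp [κ, δ, S.η_ξ, S.φ_ξ, S.φ_φ]
    ring
  rw [← sub_eq_zero, ricci, ricci, ← Finset.sum_sub_distrib, ← hT,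
    ← sum_coord_eq_trace (E := Model n) T]
  refine Finset.sum_congr rfl fun i _ ↦ ?_
  rw [← map_sub, hS.curvature_assocMetric (contMDiffAt_ext _) (contMDiffAt_ext _)
    (contMDiffAt_ext _)]
  congr 1
  simp only [ext_self, T, κ, δ, defect]
  simp [S.g_symm p (S.φ p z)]
  module

end AccRStructure

/-! ### The soliton equation with vertical potential. -/

namespace AccRStructure

variable {n : ℕ} {M : Type*} [TopologicalSpace M] [ChartedSpace (Model n) M]
  [IsManifold 𝓘(ℝ, Model n) ∞ M] {S : AccRStructure n M}

variable (S) in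
/-- The trace of an almost Einstein-like tensor with respect to `g`. -/
lemma metricTrace_metric {p : M} {a b c : ℝ} {B : Form2 (Model n) M}
    (hB : ∀ x y, B p x y
      = a * S.metric p x y + b * S.assocMetric p x y + c * (S.η p x * S.η p y)) :
    metricTrace S.metric p (B p) = (2 * n + 1) * a + b + c := by
  let T : TangentSpace 𝓘(ℝ, Model n) p →ₗ[ℝ] TangentSpace 𝓘(ℝ, Model n) p :=
    a • LinearMap.id + b • (S.φ p).toLinearMap
      + (b + c) • (S.η p).toLinearMap.smulRight (S.ξ p)
  have e : B p = fun x y ↦ S.metric p x (T y) := by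
    ext x y
    rw [hB]
    simp [T, metric, assocMetric, S.g_ξ_right]
    ring
  rw [e, S.isMetric.metricTrace_eq_trace]
  simp only [T, map_add, map_smul, trace_id, S.trace_φ, trace_smulRight]
  simp [S.η_ξ]
  ring

variable (S) in
/-- The trace of an almost Einstein-like tensor with respect to `g̃`. -/
lemma metricTrace_assocMetric {p : M} {a b c : ℝ} {B : Form2 (Model n) M}
    (hB : ∀ x y, B p x y
      = a * S.metric p x y + b * S.assocMetric p x y + c * (S.η p x * S.η p y)) :
    metricTrace S.assocMetric p (B p) = a + (2 * n + 1) * b + c := by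
  -- Raising an index with `g̃` turns `g` into `-φ + η ⊗ ξ`, of trace `1`.
  let T : TangentSpace 𝓘(ℝ, Model n) p →ₗ[ℝ] TangentSpace 𝓘(ℝ, Model n) p :=
    b • LinearMap.id - a • (S.φ p).toLinearMap
      + (a + c) • (S.η p).toLinearMap.smulRight (S.ξ p)
  have e : B p = fun x y ↦ S.assocMetric p x (T y) := by
    ext x y
    rw [hB]
    simp [T, metric, assocMetric, S.g_ξ_right, S.φ_φ, S.φ_ξ, S.η_φ, S.η_ξ]
    ring
  rw [e, S.isMetric_assocMetric.metricTrace_eq_trace]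
  simp only [T, map_add, map_sub, map_smul, trace_id, S.trace_φ, trace_smulRight]
  simp [S.η_ξ]
  ring

/-- The Ricci tensor of a Sasaki-like soliton with vertical potential `kξ`. -/
lemma IsSasakiLike.ricci_of_soliton (hS : S.IsSasakiLike) {β : ℝ} {lam lamT k : M → ℝ}
    (hk : MDifferentiable 𝓘(ℝ, Model n) 𝓘(ℝ, ℝ) k)
    (hsol : S.IsRBLikeAlmostSoliton β (fun p ↦ k p • S.ξ p) lam lamT) (p : M)
    (x y : TangentSpace 𝓘(ℝ, Model n) p) :
    S.ρ p x y = -(lam p + β * S.τ p + k p) * S.metric p x y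
      - (lamT p + β * S.τT p - k p) * S.assocMetric p x y
      - mvfderiv 𝓘(ℝ, Model n) k p x * S.η p y - mvfderiv 𝓘(ℝ, Model n) k p y * S.η p x := by
  have h := hsol p x y
  have hξ := S.mdiffAt_ξ p
  have hn : ∀ v : TangentSpace 𝓘(ℝ, Model n) p,
      nabla S.assocMetric (ext v) S.ξ p = -S.φ p v := fun v ↦ by
    rw [hS.nabla_assocMetric (mdiffAt_ext v) hξ, S.defect_ξ_right, hS.nabla_ξ (mdiffAt_ext v)]
    simp
  -- The `∇ξ` terms contribute `-k g(x,φy)` from `g` and `k (g - η ⊗ η)` from `g̃`. Since `g(x,φy) =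
  -- g̃ - η ⊗ η`, they add up to `k g - k g̃`.
  rw [S.isMetric.lieDeriv_smul (hk p) hξ, S.isMetric_assocMetric.lieDeriv_smul (hk p) hξ,
    hn, hn, hS.nabla_ξ (mdiffAt_ext x), hS.nabla_ξ (mdiffAt_ext y)] at h
  simp only [metric, assocMetric, ext_self, map_neg, neg_apply, S.g_φ_φ, S.φ_φ, S.φ_ξ, map_zero,
    map_add, map_smul, S.g_ξ_left, S.g_ξ_right, S.η_φ, S.η_ξ,
    S.g_φ_left, smul_eq_mul] at h ⊢
  linear_combination h

/-- On a Sasaki-like soliton with vertical potential `kξ`, the differential of `k` is a multiple of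
`η`, and the coefficients of the Ricci tensor are determined by the scalar curvatures. -/
lemma IsSasakiLike.soliton_coefficients (hn : 1 ≤ n) (hS : S.IsSasakiLike) {β : ℝ}
    {lam lamT k : M → ℝ} (hk : MDifferentiable 𝓘(ℝ, Model n) 𝓘(ℝ, ℝ) k)
    (hsol : S.IsRBLikeAlmostSoliton β (fun p ↦ k p • S.ξ p) lam lamT) (p : M) :
    (∀ x : TangentSpace 𝓘(ℝ, Model n) p, mvfderiv 𝓘(ℝ, Model n) k p x
        = mvfderiv 𝓘(ℝ, Model n) k p (S.ξ p) * S.η p x)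
      ∧ lam p + β * S.τ p + k p = 1 - S.τ p / (2 * n)
      ∧ lamT p + β * S.τT p - k p = 1 - S.τT p / (2 * n)
      ∧ 2 * mvfderiv 𝓘(ℝ, Model n) k p (S.ξ p)
        = (S.τ p + S.τT p) / (2 * n) - 2 * (n + 1) := by
  have hn0 : (n : ℝ) ≠ 0 := by positivity
  have hρ := hS.ricci_of_soliton hk hsol p
  set a := lam p + β * S.τ p + k p with ha
  set b := lamT p + β * S.τT p - k p with hb
  set d := mvfderiv 𝓘(ℝ, Model n) k p (S.ξ p) with hd
  have hξ : ∀ x, 2 * n * S.η p x = -(a + b + d) * S.η p x - mvfderiv 𝓘(ℝ, Model n) k p x := by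
    intro x
    rw [← hS.ricci_ξ, hρ, S.assocMetric_symm, S.assocMetric_ξ_left, S.η_ξ, metric, S.g_ξ_right]
    ring
  have hξξ := hξ (S.ξ p)
  rw [S.η_ξ, ← hd] at hξξ
  have hdk : ∀ x : TangentSpace 𝓘(ℝ, Model n) p, mvfderiv 𝓘(ℝ, Model n) k p x = d * S.η p x :=
    fun x ↦ by linear_combination hξ x - S.η p x * hξξ
  have hform : ∀ x y, S.ρ p x y
      = -a * S.metric p x y + -b * S.assocMetric p x y + -(2 * d) * (S.η p x * S.η p y) := by
    intro x y
    rw [hρ, hdk x, hdk y]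
    ring
  have hτ : S.τ p = (2 * n + 1) * -a + -b + -(2 * d) := S.metricTrace_metric hform
  have hτT : S.τT p = -a + (2 * n + 1) * -b + -(2 * d) := by
    rw [τT, scalarCurvature, hS.ricci_assocMetric]
    exact S.metricTrace_assocMetric hform
  -- `hξξ` says `a + b + 2d = -2n`, which reduces the trace to `τ = -2n a + 2n`; likewise for `b`.
  have ha' : a = 1 - S.τ p / (2 * n) := by
    field_simp
    linear_combination hτ - hξξ
  have hb' : b = 1 - S.τT p / (2 * n) := by
    field_simp
    linear_combination hτT - hξξ
  refine ⟨hdk, ha', hb', ?_⟩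
  rw [add_div]
  linear_combination hξξ - ha' - hb'

end AccRStructure

end AccR

end

/-! ### Solving for the scalar curvatures according to `β`. -/

theorem theorem2 {n : ℕ} (hn : 1 ≤ n)
    {M : Type*} [TopologicalSpace M] [ChartedSpace (AccR.Model n) M]
    [IsManifold 𝓘(ℝ, AccR.Model n) ∞ M]
    (S : AccR.AccRStructure n M) (hS : S.IsSasakiLike)
    (β : ℝ) (lam lamT k : M → ℝ)
    (hk : MDifferentiable 𝓘(ℝ, AccR.Model n) 𝓘(ℝ, ℝ) k)
    (hsol : S.IsRBLikeAlmostSoliton β (fun p ↦ k p • S.ξ p) lam lamT) :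
    S.IsAlmostEinsteinLike
        (fun p ↦ S.τ p / (2 * n) - 1)
        (fun p ↦ S.τT p / (2 * n) - 1)
        (fun p ↦ -((S.τ p + S.τT p) / (2 * n) - 2 * (n + 1)))
    ∧ (∀ (p : M) (x : TangentSpace 𝓘(ℝ, AccR.Model n) p),
        mvfderiv 𝓘(ℝ, AccR.Model n) k p x
          = mvfderiv 𝓘(ℝ, AccR.Model n) k p (S.ξ p) * S.η p x)
    ∧ (β ≠ -1 / (2 * n) →
        ∀ p : M,
          S.τ p = -(2 * n) / (1 + 2 * n * β) * (lam p + k p - 1)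
          ∧ S.τT p = -(2 * n) / (1 + 2 * n * β) * (lamT p - k p - 1)
          ∧ mvfderiv 𝓘(ℝ, AccR.Model n) k p (S.ξ p)
              = -(lam p + lamT p - 2) / (2 * (1 + 2 * n * β)) - n - 1)
    ∧ (β = -1 / (2 * n) →
        ∀ p : M,
          S.τ p + S.τT p
              = 4 * n * (mvfderiv 𝓘(ℝ, AccR.Model n) k p (S.ξ p) + n + 1)
          ∧ lam p = 1 - k p
          ∧ lamT p = 1 + k p) := by
  have hn0 : (n : ℝ) ≠ 0 := by positivity
  have H := hS.soliton_coefficients hn hk hsol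
  refine ⟨fun p x y ↦ ?_, fun p ↦ (H p).1, fun hβ p ↦ ?_, fun hβ p ↦ ?_⟩
  · obtain ⟨hdk, ha, hb, hd⟩ := H p
    rw [hS.ricci_of_soliton hk hsol p x y, hdk x, hdk y, ha, hb]
    linear_combination -(S.η p x * S.η p y) * hd
  · obtain ⟨-, ha, hb, hd⟩ := H p
    have hβ' : 1 + 2 * n * β ≠ 0 := fun h ↦ hβ (by field_simp; linarith)
    have h1 : S.τ p * (1 + 2 * n * β) = -(2 * n) * (lam p + k p - 1) := by
      field_simp at ha
      linear_combination ha
    have h2 : S.τT p * (1 + 2 * n * β) = -(2 * n) * (lamT p - k p - 1) := by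
      field_simp at hb
      linear_combination hb
    have h1' : S.τ p = -(2 * n) / (1 + 2 * n * β) * (lam p + k p - 1) := by
      rw [div_mul_eq_mul_div, eq_div_iff hβ', h1]
    have h2' : S.τT p = -(2 * n) / (1 + 2 * n * β) * (lamT p - k p - 1) := by
      rw [div_mul_eq_mul_div, eq_div_iff hβ', h2]
    refine ⟨h1', h2', ?_⟩
    rw [h1', h2'] at hd
    field_simp at hd ⊢
    linear_combination hd
  · obtain ⟨-, ha, hb, hd⟩ := H p
    -- For `β = -1/(2n)` the scalar curvatures cancel from `ha` and `hb`, which fix `λ` and `λ̃`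
    -- instead; only `hd` still constrains `τ + τ̃`.
    rw [hβ] at ha hb
    refine ⟨?_, ?_, ?_⟩
    · field_simp at hd
      linear_combination -hd
    · linear_combination ha
    · linear_combination hb
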